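/- For a prime power $q$, an integer $n\ge 1$ and an integer $r\ge 1$, let $L_n^*(\mathbf F_q)$ be the poset, ordered by inclusion, of all nonzero proper subspaces of $\mathbf F_q^n$, with its natural action of $\mathrm{GL}_n(\mathbf F_q)$. Put $$\widetilde\chi_r(n,q)=\frac{1}{|\mathrm{GL}_n(\mathbf F_q)|}\sum_{X\in \mathrm{Hom}(\mathbf Z^r,\mathrm{GL}_n(\mathbf F_q))}\widetilde\chi\bigl(C_{L_n^*(\mathbf F_q)}(X(\mathbf Z^r))\bigr),$$ where $C_{L_n^*(\mathbf F_q)}(H)$ is the subposet of $H$-invariant subspaces, and where the reduced Euler characteristic of a finite poset is $\widetilde\chi(P)=\sum_{c}(-1)^{|c|-1}$, the sum over all chains $c$ of $P$ including the empty one (so $\widetilde\chi(\emptyset)=-1$). Then for every odd $r\ge 1$ and every $n\ge 1$ there is a unique polynomial in $\mathbf Z[q]$ whose value at each prime power $q$ is $\widetilde\chi_r(n,q)$, and this polynomial is divisible by $q^{n-1}$ in $\mathbf Z[q]$. -/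

import Mathlib

universe u

/-- The reduced Euler characteristic of (the order complex of) a finite poset `P`:
the sum of `(-1) ^ (dim c)` over all chains `c` in `P`, with `dim c = |c| - 1`.
The empty chain is included and contributes `-1`; so the empty poset has value `-1`.
The chains form a finite type, so the sum is an honest finite sum. -/
noncomputable def redEulerChar (P : Type*) [PartialOrder P] [Finite P] : ℤ :=
  ∑ᶠ c : {c : Finset P // IsChain (· ≤ ·) (c : Set P)}, (-1) ^ (c.1.card + 1)

/-- The homomorphisms `ℤ^r → G` to a finite group `G` form a finite set. -/
instance finite_zpowHom (r : ℕ) (G : Type*) [Group G] [Finite G] :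
    Finite (Multiplicative (Fin r → ℤ) →* G) := by
  refine Finite.of_injective
    (fun (X : Multiplicative (Fin r → ℤ) →* G) (i : Fin r) =>
      X (Multiplicative.ofAdd (Pi.single i 1))) fun X Y h => ?_
  have key : ∀ i : Fin r,
      X.comp (AddMonoidHom.toMultiplicative (AddMonoidHom.single (fun _ : Fin r => ℤ) i)) =
        Y.comp (AddMonoidHom.toMultiplicative (AddMonoidHom.single (fun _ : Fin r => ℤ) i)) :=
    fun i => MonoidHom.ext_mint (congrFun h i)
  refine MonoidHom.ext fun v => ?_
  have hv : v = ∏ i, Multiplicative.ofAdd (Pi.single i (v.toAdd i)) := by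
    rw [← ofAdd_sum, Finset.univ_sum_single]
    rfl
  have hX : v ∈ MonoidHom.eqLocus X Y := by
    rw [hv]
    exact Subgroup.prod_mem _ fun i _ =>
      DFunLike.congr_fun (key i) (Multiplicative.ofAdd (v.toAdd i))
  exact hX

/-- The `r`th equivariant reduced Euler characteristic of the finite `G`-poset `P`: the sum,
divided by `|G|`, of the reduced Euler characteristics of the subposets of `P` fixed by the
image of `X`, over all homomorphisms `X : ℤ^r → G`. -/
noncomputable def eqvRedEulerChar (r : ℕ) (P G : Type*) [PartialOrder P] [Finite P]
    [Group G] [Finite G] [MulAction G P] : ℚ :=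
  (Nat.card G : ℚ)⁻¹ *
    ∑ᶠ X : Multiplicative (Fin r → ℤ) →* G, (redEulerChar (MulAction.fixedPoints X.range P) : ℚ)

/-- The poset of nonzero proper subspaces of a vector space, ordered by inclusion. -/
abbrev ProperSubspaces (F V : Type*) [Field F] [AddCommGroup V] [Module F V] : Type _ :=
  {W : Submodule F V // W ≠ ⊥ ∧ W ≠ ⊤}

/-- The general linear group of `V` acts on the nonzero proper subspaces: `g • W = g(W)`. -/
instance properSubspacesMulAction (F V : Type*) [Field F] [AddCommGroup V] [Module F V] :
    MulAction (LinearMap.GeneralLinearGroup F V) (ProperSubspaces F V) where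
  smul g W := ⟨W.1.map (g : V →ₗ[F] V), by
    have hg : Function.Bijective (g : V →ₗ[F] V) :=
      (LinearMap.GeneralLinearGroup.toLinearEquiv g).bijective
    refine ⟨fun h => W.2.1 ?_, fun h => W.2.2 ?_⟩
    · exact (Submodule.map_injective_of_injective hg.1) (h.trans (Submodule.map_bot _).symm)
    · refine (Submodule.map_injective_of_injective hg.1) (h.trans ?_)
      rw [Submodule.map_top, LinearMap.range_eq_top.2 hg.2]⟩
  one_smul W := Subtype.ext (Submodule.map_id W.1)
  mul_smul g h W := Subtype.ext (Submodule.map_comp (h : V →ₗ[F] V) (g : V →ₗ[F] V) W.1)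

/-- The general linear group of a finite vector space is finite. -/
instance finite_generalLinearGroup (F V : Type*) [Field F] [AddCommGroup V] [Module F V]
    [Finite V] : Finite (LinearMap.GeneralLinearGroup F V) :=
  haveI : Finite (Module.End F V) := DFunLike.finite _
  inferInstanceAs (Finite (Module.End F V)ˣ)

/-- The `r`th equivariant reduced Euler characteristic of the poset of nonzero proper
subspaces of `F ^ n`, with its action of the general linear group, for a finite field `F`. -/
noncomputable def chiGL (r n : ℕ) (F : Type*) [Field F] [Finite F] : ℚ :=
  eqvRedEulerChar r (ProperSubspaces F (Fin n → F))
    (LinearMap.GeneralLinearGroup F (Fin n → F))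

/-- The polynomial `P` with integer coefficients represents the `r`th equivariant reduced
Euler characteristic in dimension `n` as a function of the size `q` of the finite field
(of any prime power order). -/
def RepresentsChiGL (r n : ℕ) (P : Polynomial ℤ) : Prop :=
  ∀ (F : Type u) [Field F] [Finite F], chiGL r n F = ((P.eval (Nat.card F : ℤ) : ℤ) : ℚ)

/-! A homomorphism from `ℤ^r` to `GL_n(F)` is an `n`-dimensional representation of the commutative
algebra `A = F[ℤ^r]`, and the invariant subspaces are its submodules. By Hall's theorem the summand
for `X` is the Möbius number of the submodule lattice, so the invariant is a sum of these numbers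
over all representations, divided by `|GL_n(F)|` (`chiGL_eq_repSum`).

A finite lattice with nonzero Möbius number is complemented, so only semisimple modules contribute.
Such a module splits into its parts killed by the maximal ideals `m` of `A`, and Möbius numbers
multiply along the splitting. Hence the generating series is morally an Euler product over the `m`,
where `m` with residue degree `d` contributes `∑ⱼ qCoeff (q^d) j * t^(d*j)`, equal to `∏_{i ≥ 1} (1
- q^(-d*i) t^d)`.

The infinite product is replaced by its logarithmic derivative: weighting each representation by `n
= ∑_m dim M[m]` gives the recursion `n a_n = -∑_k N_k / (q^k - 1) * a_(n-k)` (`natCast_mul_repSum`),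
where `N_k = (q^k - 1)^r` counts the points of `A` in the field of `q^k` elements. For `r = 2s + 1`
the coefficient is `(q^k - 1)^(2s)`, and by the binomial theorem `∏ⱼ (1 - q^j t)^((-1)^j (2s choose
j))` satisfies the same recursion. Its factors with `j ≥ 1` are series in `q t` with coefficients in
`ℤ[q]`, and the factor for `j = 0` is `1 - t`, which costs one power of `q`. Uniqueness holds
because the values at all primes determine a polynomial. -/

/-! ### Möbius numbers of finite posets and lattices. -/

section Moebius

open Finset Classical

variable {L : Type*}

/-- A function on a finite poset with least element `⊥` is a Möbius function (with first
argument fixed to `⊥`) if its sum over each lower interval `[⊥, x]` is `1` or `0`, according to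
whether `x = ⊥` or not. -/
def IsMoebius [PartialOrder L] [OrderBot L] [Fintype L] (f : L → ℤ) : Prop :=
  ∀ x, ∑ y with y ≤ x, f y = if x = ⊥ then 1 else 0

theorem exists_isMoebius (L : Type*) [PartialOrder L] [OrderBot L] [Fintype L] :
    ∃ f : L → ℤ, IsMoebius f := by
  let := Fintype.toLocallyFiniteOrder (α := L)
  refine ⟨fun x => IncidenceAlgebra.mu ℤ ⊥ x, fun x => ?_⟩
  have h := IncidenceAlgebra.sum_Icc_mu_right (𝕜 := ℤ) (⊥ : L) x
  rw [show ({y | y ≤ x} : Finset L) = Finset.Icc ⊥ x by ext; simp, h]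
  simp [eq_comm]

theorem IsMoebius.unique [PartialOrder L] [OrderBot L] [Fintype L] {f g : L → ℤ}
    (hf : IsMoebius f) (hg : IsMoebius g) : f = g := by
  funext x
  induction x using WellFoundedLT.induction with
  | ind x ih =>
    have h := (hf x).trans (hg x).symm
    have hx : ({y | y ≤ x} : Finset L) = insert x ({y | y < x} : Finset L) := by
      ext y; simp [le_iff_eq_or_lt]
    rw [hx, sum_insert (by simp), sum_insert (by simp)] at h
    have h2 : ∑ y with y < x, f y = ∑ y with y < x, g y :=
      sum_congr rfl fun y hy => ih y (by simpa using hy)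
    linarith

theorem IsMoebius.bot [PartialOrder L] [OrderBot L] [Fintype L] {f : L → ℤ}
    (hf : IsMoebius f) : f ⊥ = 1 := by
  have h := hf ⊥
  rw [if_pos rfl, show ({y | y ≤ ⊥} : Finset L) = {⊥} by ext; simp, sum_singleton] at h
  exact h

/-- The Möbius number `μ(⊥, ⊤)` of a finite bounded poset. -/
noncomputable def moebiusNumber (L : Type*) [PartialOrder L] [BoundedOrder L] [Finite L] : ℤ :=
  letI := Fintype.ofFinite L
  (exists_isMoebius L).choose ⊤

theorem IsMoebius.top_eq [PartialOrder L] [BoundedOrder L] [hL : Fintype L] {f : L → ℤ}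
    (hf : IsMoebius f) : f ⊤ = moebiusNumber L := by
  -- `moebiusNumber` builds its own `Fintype` instance, so the comparison is made for an arbitrary
  -- one.
  have key : ∀ h : Fintype L, f = (@exists_isMoebius L _ _ h).choose := by
    intro h
    obtain rfl := Subsingleton.elim hL h
    exact hf.unique (exists_isMoebius L).choose_spec
  exact congrFun (key _) ⊤

theorem moebiusNumber_congr {L' : Type*} [PartialOrder L] [BoundedOrder L] [Finite L]
    [PartialOrder L'] [BoundedOrder L'] [Finite L'] (e : L ≃o L') :
    moebiusNumber L = moebiusNumber L' := by
  let := Fintype.ofFinite L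
  let := Fintype.ofFinite L'
  obtain ⟨f, hf⟩ := exists_isMoebius L'
  have : IsMoebius (f ∘ e) := by
    intro x
    have h := hf (e x)
    rw [show (e x = ⊥ ↔ x = ⊥) by simp] at h
    rw [← h]
    refine sum_equiv e.toEquiv (by simp) (by simp)
  rw [← this.top_eq, ← hf.top_eq]
  simp

theorem moebiusNumber_of_subsingleton [PartialOrder L] [BoundedOrder L] [Finite L]
    [Subsingleton L] : moebiusNumber L = 1 := by
  let := Fintype.ofFinite L
  obtain ⟨f, hf⟩ := exists_isMoebius L
  rw [← hf.top_eq, Subsingleton.elim (⊤ : L) ⊥, hf.bot]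

theorem moebiusNumber_prod {L' : Type*} [PartialOrder L] [BoundedOrder L] [Finite L]
    [PartialOrder L'] [BoundedOrder L'] [Finite L'] :
    moebiusNumber (L × L') = moebiusNumber L * moebiusNumber L' := by
  let := Fintype.ofFinite L
  let := Fintype.ofFinite L'
  obtain ⟨f, hf⟩ := exists_isMoebius L
  obtain ⟨g, hg⟩ := exists_isMoebius L'
  have : IsMoebius (fun p : L × L' => f p.1 * g p.2) := by
    rintro ⟨x, y⟩
    have h : ({p | p ≤ (x, y)} : Finset (L × L')) =
        ({a | a ≤ x} : Finset L) ×ˢ ({b | b ≤ y} : Finset L') := by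
      ext ⟨a, b⟩; simp
    refine Eq.trans (sum_congr (s₂ := ({a | a ≤ x} : Finset L) ×ˢ ({b | b ≤ y} : Finset L'))
      (by convert h) fun _ _ => rfl) ?_
    rw [sum_product, ← sum_mul_sum, hf, hg]
    by_cases hx : x = ⊥ <;> by_cases hy : y = ⊥ <;> simp [Prod.ext_iff, hx, hy]
  rw [← hf.top_eq, ← hg.top_eq, ← this.top_eq]
  rfl

theorem IsMoebius.apply_eq [PartialOrder L] [OrderBot L] [Fintype L] {f : L → ℤ}
    (hf : IsMoebius f) (x : L) : f x = moebiusNumber (Set.Iic x) := by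
  have : IsMoebius (fun y : Set.Iic x => f y) := by
    intro y
    have h := hf y
    rw [show ((y : L) = ⊥ ↔ y = ⊥) by rw [Subtype.ext_iff]; rfl] at h
    rw [← h]
    refine sum_bij (fun z _ => (z : L)) (by simp) (by simp) ?_ (by simp)
    intro b hb
    simp only [mem_filter, mem_univ, true_and] at hb
    exact ⟨⟨b, hb.trans y.2⟩, by simpa [← Subtype.coe_le_coe] using hb, rfl⟩
  rw [← this.top_eq]
  rfl

/-- Weisner's theorem. -/
theorem IsMoebius.sum_sup_eq [Lattice L] [OrderBot L] [Fintype L] {f : L → ℤ}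
    (hf : IsMoebius f) {a : L} (ha : a ≠ ⊥) (b : L) : ∑ x with x ⊔ a = b, f x = 0 := by
  induction b using WellFoundedLT.induction with
  | ind b ih =>
    by_cases hab : a ≤ b
    · have h := hf b
      rw [if_neg (fun h' : b = ⊥ => ha (le_bot_iff.1 (h' ▸ hab)))] at h
      -- The vanishing sum over `[⊥, b]` is split by the value of `y ⊔ a`. The fibres over `c < b`
      -- vanish by induction, which leaves the fibre over `b`.
      rw [← sum_fiberwise_of_maps_to (s := ({y | y ≤ b} : Finset L))
        (t := ({y | y ≤ b} : Finset L)) (g := fun y => y ⊔ a) (by simp [hab]),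
        show ({y | y ≤ b} : Finset L) = insert b ({y | y < b} : Finset L) by
          ext y; simp [le_iff_eq_or_lt], sum_insert (by simp)] at h
      rw [sum_eq_zero (s := ({y | y < b} : Finset L)), add_zero] at h
      · rw [← h]
        refine sum_congr ?_ fun _ _ => rfl
        ext y
        simp only [mem_filter, mem_univ, true_and, mem_insert, ← le_iff_eq_or_lt]
        exact ⟨fun h => ⟨h ▸ le_sup_left, h⟩, fun h => h.2⟩
      · intro c hc
        simp only [mem_filter, mem_univ, true_and] at hc
        rw [← ih c hc]
        refine sum_congr ?_ fun _ _ => rfl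
        ext y
        simp only [mem_filter, mem_univ, true_and, mem_insert, ← le_iff_eq_or_lt]
        exact ⟨fun h => h.2, fun h => ⟨(h ▸ le_sup_left : y ≤ c).trans hc.le, h⟩⟩
    · rw [filter_eq_empty_iff.2, sum_empty]
      rintro x - rfl
      exact hab le_sup_right

/-- Weisner's theorem for `a` expresses `f x` through the `f y` with `y < x` and `y ⊔ a = x`. These
vanish by induction with `y ⊓ a` in place of `a`: a complement of `y ⊓ a` below `y` would also be a
complement of `a` below `x`. -/
theorem IsMoebius.eq_zero_of_forall_inf_ne_bot [Lattice L] [OrderBot L] [Fintype L] {f : L → ℤ}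
    (hf : IsMoebius f) (x a : L) (hax : a ≤ x) (h : ∀ y, y ⊔ a = x → y ⊓ a ≠ ⊥) : f x = 0 := by
  induction x using WellFoundedLT.induction generalizing a with
  | ind x ih =>
    have ha : a ≠ ⊥ := by
      simpa [hax] using h x (by simpa using hax)
    rw [← hf.sum_sup_eq ha x, eq_comm]
    refine sum_eq_single_of_mem x (by simpa using hax) fun y hy hyx => ?_
    simp only [mem_filter, mem_univ, true_and] at hy
    refine ih y (lt_of_le_of_ne (hy ▸ le_sup_left) hyx) (y ⊓ a) inf_le_left fun z hz hz0 => ?_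
    refine h z ?_ ?_
    · calc z ⊔ a = (z ⊔ y ⊓ a) ⊔ a := by rw [sup_assoc, sup_eq_right.2 (inf_le_right : y ⊓ a ≤ a)]
        _ = x := by rw [hz, hy]
    · rwa [← inf_assoc, inf_eq_left.2 (hz ▸ le_sup_left : z ≤ y)] at hz0

/-- The Möbius number of a finite lattice with a non-complemented element is zero. -/
theorem exists_isCompl_of_moebiusNumber_ne_zero [Lattice L] [BoundedOrder L] [Finite L]
    (h : moebiusNumber L ≠ 0) (a : L) : ∃ b, IsCompl a b := by
  let := Fintype.ofFinite L
  obtain ⟨f, hf⟩ := exists_isMoebius L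
  by_contra! hc
  refine h (hf.top_eq ▸ hf.eq_zero_of_forall_inf_ne_bot ⊤ a le_top fun y hy hy0 => ?_)
  exact hc y (IsCompl.of_eq (inf_comm a y ▸ hy0) (sup_comm a y ▸ hy))

/-- The signed count of the chains contained in a set. -/
noncomputable def signedChainCount [PartialOrder L] [Fintype L] (S : Set L) : ℤ :=
  ∑ c ∈ (univ : Finset (Finset L)).filter
    fun c : Finset L => IsChain (· ≤ ·) (c : Set L) ∧ (c : Set L) ⊆ S, (-1) ^ (c.card + 1)

theorem redEulerChar_subtype [PartialOrder L] [Fintype L] (p : L → Prop) :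
    redEulerChar {x // p x} = signedChainCount {x | p x} := by
  unfold redEulerChar signedChainCount
  rw [finsum_eq_sum_of_fintype]
  refine sum_bij (fun c _ => c.1.map (Function.Embedding.subtype p)) ?_ ?_ ?_ ?_
  · rintro ⟨c, hc⟩ -
    simp only [mem_filter, mem_univ, true_and]
    constructor
    · rw [coe_map]
      rintro _ ⟨x, hx, rfl⟩ _ ⟨y, hy, rfl⟩ hxy
      exact hc hx hy (fun h => hxy (by rw [h]))
    · rw [coe_map]
      rintro _ ⟨x, hx, rfl⟩
      exact x.2
  · rintro c - d - h
    exact Subtype.ext (Finset.map_injective _ h)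
  · intro c hc
    simp only [mem_filter, mem_univ, true_and] at hc
    refine ⟨⟨c.subtype p, ?_⟩, mem_univ _, ?_⟩
    · intro x hx y hy hxy
      exact hc.1 (by simpa using hx) (by simpa using hy) (fun h => hxy (Subtype.ext h))
    · ext x
      simp only [mem_map, mem_subtype, Function.Embedding.subtype_apply]
      exact ⟨by rintro ⟨y, hy, rfl⟩; exact hy, fun hx => ⟨⟨x, hc.2 hx⟩, hx, rfl⟩⟩
  · intro c _
    rw [card_map]

/-- Nonempty chains are sorted by their greatest element `y`; deleting it changes the sign and
leaves a chain in `Ioo a y`. -/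
theorem signedChainCount_Ioo [PartialOrder L] [Fintype L] (a x : L) :
    signedChainCount (Set.Ioo a x) =
      -1 - ∑ y with a < y ∧ y < x, signedChainCount (Set.Ioo a y) := by
  have key : ((univ : Finset (Finset L)).filter
      fun c : Finset L => IsChain (· ≤ ·) (c : Set L) ∧ (c : Set L) ⊆ Set.Ioo a x) =
      insert ∅ (({y | a < y ∧ y < x} : Finset L).biUnion fun y =>
        ((univ : Finset (Finset L)).filter fun c : Finset L => IsChain (· ≤ ·) (c : Set L) ∧
          (c : Set L) ⊆ Set.Ioo a y).image (insert y)) := by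
    ext c
    simp only [mem_filter, mem_univ, true_and, mem_insert, mem_biUnion, mem_image]
    constructor
    · rintro ⟨hc, hcx⟩
      rcases c.eq_empty_or_nonempty with h | h
      · exact Or.inl h
      · obtain ⟨y, hy, hmax⟩ := c.exists_maximal h
        refine Or.inr ⟨y, hcx hy, c.erase y, ⟨hc.mono (by simp), ?_⟩, insert_erase hy⟩
        intro z hz
        simp only [coe_erase, Set.mem_sdiff, mem_coe, Set.mem_singleton_iff] at hz
        refine ⟨(hcx hz.1).1, lt_of_le_of_ne ?_ hz.2⟩
        rcases hc hz.1 hy hz.2 with h1 | h1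
        · exact h1
        · exact hmax hz.1 h1
    · rintro (rfl | ⟨y, hy, c, ⟨hc, hcy⟩, rfl⟩)
      · simp
      · refine ⟨?_, ?_⟩
        · rw [coe_insert]
          exact hc.insert fun b hb _ => Or.inr (hcy hb).2.le
        · rw [coe_insert, Set.insert_subset_iff]
          exact ⟨hy, fun z hz => ⟨(hcy hz).1, (hcy hz).2.trans hy.2⟩⟩
  rw [signedChainCount, key, sum_insert (by simp), sum_biUnion]
  · rw [sub_eq_add_neg, ← sum_neg_distrib]
    congr 1
    refine sum_congr rfl fun y hy => ?_
    have hny : ∀ c : Finset L, (c : Set L) ⊆ Set.Ioo a y → y ∉ c := fun c hc hyc =>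
      lt_irrefl _ (hc hyc).2
    rw [sum_image, signedChainCount, ← sum_neg_distrib]
    · refine sum_congr rfl fun c hc => ?_
      simp only [mem_filter, mem_univ, true_and] at hc
      rw [card_insert_of_notMem (hny c hc.2)]
      ring
    · intro c hc d hd hcd
      simp only [coe_filter, mem_univ, true_and, Set.mem_ofPred_eq] at hc hd
      rw [← erase_insert (hny c hc.2), ← erase_insert (hny d hd.2)]
      exact congrArg (fun t => erase t y) hcd
  · intro y hy z hz hyz
    rw [Function.onFun, Finset.disjoint_left]
    intro c hc hc'
    simp only [mem_filter, mem_univ, true_and, mem_image] at hc hc'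
    obtain ⟨c1, ⟨-, h1⟩, rfl⟩ := hc
    obtain ⟨c2, ⟨-, h2⟩, h⟩ := hc'
    have hy' : y ∈ insert z c2 := h ▸ mem_insert_self _ _
    have hz' : z ∈ insert y c1 := h ▸ mem_insert_self _ _
    rw [mem_insert] at hy' hz'
    rcases hy' with h' | h'
    · exact hyz h'
    rcases hz' with h'' | h''
    · exact hyz h''.symm
    exact lt_asymm (h2 h').2 (h1 h'').2

/-- Philip Hall's theorem. -/
theorem redEulerChar_eq_moebiusNumber [PartialOrder L] [BoundedOrder L] [Finite L]
    [Nontrivial L] : redEulerChar {x : L // x ≠ ⊥ ∧ x ≠ ⊤} = moebiusNumber L := by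
  let := Fintype.ofFinite L
  -- The chain recursion is the recursion defining a Möbius function. The value at `⊥` is set
  -- separately, since the chain count of the empty interval is `-1`.
  have h : IsMoebius fun x : L => if x = ⊥ then 1 else signedChainCount (Set.Ioo ⊥ x) := by
    intro x
    by_cases hx : x = ⊥
    · subst hx
      rw [show ({y | y ≤ ⊥} : Finset L) = {⊥} by ext; simp]
      simp
    · rw [if_neg hx, show ({y | y ≤ x} : Finset L) =
        insert ⊥ (insert x ({y | ⊥ < y ∧ y < x} : Finset L)) by
          ext y
          simp only [mem_filter, mem_univ, true_and, mem_insert, le_iff_eq_or_lt (a := y)]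
          constructor
          · rintro (h | h)
            · exact Or.inr (Or.inl h)
            · rcases eq_or_ne y ⊥ with h' | h'
              · exact Or.inl h'
              · exact Or.inr (Or.inr ⟨bot_lt_iff_ne_bot.2 h', h⟩)
          · rintro (h | h | h)
            · exact Or.inr (h ▸ bot_lt_iff_ne_bot.2 hx)
            · exact Or.inl h
            · exact Or.inr h.2,
        sum_insert (by simp [Ne.symm hx]), sum_insert (by simp), if_pos rfl, if_neg hx,
        signedChainCount_Ioo]
      have h : ∀ y ∈ ({y | ⊥ < y ∧ y < x} : Finset L),
          (if y = ⊥ then 1 else signedChainCount (Set.Ioo ⊥ y)) =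
            signedChainCount (Set.Ioo ⊥ y) := by
        intro y hy
        simp only [mem_filter, mem_univ, true_and] at hy
        rw [if_neg hy.1.ne']
      rw [sum_congr rfl h]
      ring
  rw [← h.top_eq, if_neg top_ne_bot, redEulerChar_subtype]
  congr 1
  ext x
  simp [bot_lt_iff_ne_bot, lt_top_iff_ne_top]

theorem redEulerChar_congr {P Q : Type*} [PartialOrder P] [Finite P] [PartialOrder Q] [Finite Q]
    (e : P ≃o Q) : redEulerChar P = redEulerChar Q := by
  unfold redEulerChar
  refine finsum_eq_of_bijective
    (fun c => ⟨c.1.map e.toEquiv.toEmbedding, ?_⟩) ⟨?_, ?_⟩ ?_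
  · rw [coe_map]
    rintro _ ⟨x, hx, rfl⟩ _ ⟨y, hy, rfl⟩ hxy
    simpa using c.2 hx hy (fun h => hxy (by rw [h]))
  · intro c d h
    exact Subtype.ext (Finset.map_injective _ (congrArg Subtype.val h))
  · rintro ⟨c, hc⟩
    refine ⟨⟨c.map e.symm.toEquiv.toEmbedding, ?_⟩, ?_⟩
    · rw [coe_map]
      rintro _ ⟨x, hx, rfl⟩ _ ⟨y, hy, rfl⟩ hxy
      simpa using hc hx hy (fun h => hxy (by rw [h]))
    · refine Subtype.ext ?_
      ext x
      simp
  · intro c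
    simp

end Moebius

/-! ### Orders of general linear groups and Möbius numbers of subspace lattices. -/

section GeneralLinear

open Finset

/-- The order of the general linear group of degree `n` over a field with `Q` elements, as a
rational number. -/
def glCard (Q : ℚ) (n : ℕ) : ℚ := ∏ i ∈ range n, (Q ^ n - Q ^ i)

theorem glCard_ne_zero {Q : ℚ} (hQ : 1 < Q) (n : ℕ) : glCard Q n ≠ 0 := by
  refine prod_ne_zero_iff.2 fun i hi => ?_
  exact (sub_pos.2 (pow_lt_pow_right₀ hQ (mem_range.1 hi))).ne'

theorem glCard_succ (Q : ℚ) (n : ℕ) :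
    glCard Q (n + 1) = (Q ^ (n + 1) - 1) * Q ^ n * glCard Q n := by
  have h : ∏ i ∈ range n, (Q ^ (n + 1) - Q ^ (i + 1)) = Q ^ n * ∏ i ∈ range n, (Q ^ n - Q ^ i) := by
    calc _ = ∏ i ∈ range n, Q * (Q ^ n - Q ^ i) := prod_congr rfl fun i _ => by ring
      _ = _ := by rw [prod_mul_distrib, prod_const, card_range]
  rw [glCard, prod_range_succ', h, glCard]
  ring

theorem card_linearEquiv_pi (K : Type*) [Field K] [Finite K] (n : ℕ) :
    (Nat.card ((Fin n → K) ≃ₗ[K] (Fin n → K)) : ℚ) = glCard (Nat.card K) n := by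
  have := Fintype.ofFinite K
  rw [← Nat.card_congr (LinearMap.GeneralLinearGroup.generalLinearEquiv K (Fin n → K)).toEquiv,
    ← Nat.card_congr (Matrix.GeneralLinearGroup.toLin (n := Fin n) (R := K)).toEquiv,
    Matrix.card_GL_field, glCard, Nat.cast_prod, prod_range]
  refine prod_congr rfl fun i _ => ?_
  rw [Nat.cast_sub (Nat.pow_le_pow_right Fintype.card_pos i.2.le), Nat.card_eq_fintype_card]
  simp

theorem card_linearEquiv_of_finrank_eq (K : Type*) [Field K] [Finite K] {V W : Type*}
    [AddCommGroup V] [Module K V] [Module.Finite K V] [AddCommGroup W] [Module K W]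
    [Module.Finite K W] {n : ℕ} (hV : Module.finrank K V = n) (hW : Module.finrank K W = n) :
    (Nat.card (V ≃ₗ[K] W) : ℚ) = glCard (Nat.card K) n := by
  rw [← card_linearEquiv_pi]
  have e₁ : V ≃ₗ[K] (Fin n → K) := LinearEquiv.ofFinrankEq _ _ (by simp [hV])
  have e₂ : W ≃ₗ[K] (Fin n → K) := LinearEquiv.ofFinrankEq _ _ (by simp [hW])
  exact congrArg _ (Nat.card_congr
    ⟨fun f => e₁.symm ≪≫ₗ f ≪≫ₗ e₂, fun f => e₁ ≪≫ₗ f ≪≫ₗ e₂.symm,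
      fun f => by ext; simp, fun f => by ext; simp⟩)

/-- The Möbius number of the lattice of subspaces of a vector space of dimension `j` over a field
with `Q` elements, divided by the order of the general linear group. -/
def qCoeff (Q : ℚ) (j : ℕ) : ℚ := ∏ i ∈ range j, -(Q ^ (i + 1) - 1)⁻¹

theorem qCoeff_succ {Q : ℚ} (hQ : 1 < Q) (j : ℕ) :
    qCoeff Q (j + 1) * (Q ^ (j + 1) - 1) = -qCoeff Q j := by
  have : Q ^ (j + 1) - 1 ≠ 0 := (sub_pos.2 (one_lt_pow₀ hQ (by omega))).ne'
  rw [qCoeff, prod_range_succ, ← qCoeff]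
  field_simp

/-- This is the coefficient form of the logarithmic derivative of `∑ⱼ qCoeff Q j * t^j = ∏_{i ≥ 1}
(1 - Q^(-i) t)`, which is `-∑_{k ≥ 1} t^k / (Q^k - 1)`, with `k = i + 1`. -/
theorem natCast_mul_qCoeff {Q : ℚ} (hQ : 1 < Q) (j : ℕ) :
    j * qCoeff Q j = -∑ i ∈ range j, qCoeff Q (j - 1 - i) / (Q ^ (i + 1) - 1) := by
  induction j with
  | zero => simp
  | succ j ih =>
    have hpos : ∀ i : ℕ, Q ^ (i + 1) - 1 ≠ 0 := fun i =>
      (sub_pos.2 (one_lt_pow₀ hQ (by omega))).ne'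
    have key : (Q ^ (j + 1) - 1) * ∑ i ∈ range (j + 1),
        qCoeff Q (j + 1 - 1 - i) / (Q ^ (i + 1) - 1) = (j + 1) * qCoeff Q j := by
      -- Write `Q^(j+1) - 1 = Q^(i+1) (Q^(j-i) - 1) + (Q^(i+1) - 1)` and apply `qCoeff_succ`. Summed
      -- over `i`, the terms without denominator telescope and the others form the induction
      -- hypothesis.
      have h1 : ∀ i ∈ range j, (Q ^ (j + 1) - 1) * (qCoeff Q (j - i) / (Q ^ (i + 1) - 1)) =
          qCoeff Q (j - i) - (qCoeff Q (j - 1 - i) +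
            qCoeff Q (j - 1 - i) / (Q ^ (i + 1) - 1)) := by
        intro i hi
        obtain ⟨k, rfl⟩ : ∃ k, j = i + k + 1 := ⟨j - i - 1, by have := mem_range.1 hi; omega⟩
        rw [show i + k + 1 - i = k + 1 by omega, show i + k + 1 - 1 - i = k by omega,
          ← neg_neg (qCoeff Q k), ← qCoeff_succ hQ]
        have := hpos i
        field_simp
        ring
      have h2 : ∑ i ∈ range j, qCoeff Q (j - i) + qCoeff Q 0 =
          ∑ i ∈ range j, qCoeff Q (j - 1 - i) + qCoeff Q j := by
        have h3 := sum_range_succ (fun i => qCoeff Q (j - i)) j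
        have h4 := sum_range_succ' (fun i => qCoeff Q (j - i)) j
        simp only [Nat.sub_self, Nat.sub_zero] at h3 h4
        rw [← h3, h4]
        congr 1
        exact sum_congr rfl fun i _ => by rw [Nat.sub_sub, add_comm 1 i]
      rw [Nat.add_sub_cancel, sum_range_succ, mul_add, mul_sum, sum_congr rfl h1,
        sum_sub_distrib, sum_add_distrib, Nat.sub_self, mul_div_cancel₀ _ (hpos j)]
      linarith
    have h := qCoeff_succ hQ j
    refine mul_left_cancel₀ (hpos j) ?_
    rw [mul_neg, key]
    push_cast
    linear_combination (j + 1 : ℚ) * h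

/-- Such a subspace is the kernel of exactly one functional with value `1` at `v`, and these
functionals form a coset of the `m`-dimensional annihilator of `v`. -/
theorem card_hyperplanes_not_containing {K V : Type*} [Field K] [Finite K] [AddCommGroup V]
    [Module K V] [Module.Finite K V] {m : ℕ} (hV : Module.finrank K V = m + 1) {v : V}
    (hv : v ≠ 0) :
    Nat.card {x : Submodule K V // x ⊔ Submodule.span K {v} = ⊤ ∧ x ≠ ⊤} = Nat.card K ^ m := by
  obtain ⟨φ, hφ⟩ := Module.Projective.exists_dual_eq_one K hv
  have hfr := Subspace.finrank_add_finrank_dualAnnihilator_eq (Submodule.span K {v})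
  rw [finrank_span_singleton hv, hV, add_comm, Nat.add_right_cancel_iff] at hfr
  have hcard := Module.natCard_eq_pow_finrank (K := K)
    (V := (Submodule.span K {v}).dualAnnihilator)
  rw [hfr] at hcard
  rw [← hcard, eq_comm]
  have hann : ∀ ψ : (Submodule.span K {v}).dualAnnihilator, (φ + ψ.1) v = 1 := fun ψ => by
    have := (Submodule.mem_dualAnnihilator _).1 ψ.2 v (Submodule.mem_span_singleton_self v)
    simp [hφ, this]
  have hdecomp : ∀ χ : Module.Dual K V, χ v = 1 → ∀ w, w - χ w • v ∈ LinearMap.ker χ := by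
    intro χ h w
    simp [h]
  have hinj : ∀ χ χ' : Module.Dual K V, χ v = 1 → χ' v = 1 →
      LinearMap.ker χ ≤ LinearMap.ker χ' → χ = χ' := by
    intro χ χ' h h' hk
    ext w
    have := hk (hdecomp χ h w)
    exact (sub_eq_zero.1 (by simpa [h'] using this)).symm
  refine Nat.card_congr (Equiv.ofBijective (fun ψ => ⟨LinearMap.ker (φ + ψ.1), ?_, ?_⟩) ⟨?_, ?_⟩)
  · rw [eq_top_iff]
    intro w _
    rw [← sub_add_cancel w ((φ + ψ.1) w • v)]
    exact Submodule.add_mem_sup (hdecomp _ (hann ψ) w)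
      (Submodule.smul_mem _ _ (Submodule.mem_span_singleton_self v))
  · intro h
    have : v ∈ LinearMap.ker (φ + ψ.1) := h ▸ Submodule.mem_top
    rw [LinearMap.mem_ker, hann] at this
    exact one_ne_zero this
  · intro ψ ψ' h
    have h' := congrArg Subtype.val h
    exact Subtype.ext (add_left_cancel (hinj _ _ (hann ψ) (hann ψ') h'.le))
  · rintro ⟨x, hx, hx'⟩
    have hvx : v ∉ x := fun h => hx' (by
      rw [← hx, eq_comm, sup_eq_left]; simpa using h)
    obtain ⟨f, hf, hxf⟩ := Submodule.exists_le_ker_of_notMem hvx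
    have h1 : ((f v)⁻¹ • f) v = 1 := by simp [hf]
    refine ⟨⟨(f v)⁻¹ • f - φ, ?_⟩, Subtype.ext ?_⟩
    · rw [Submodule.mem_dualAnnihilator]
      intro w hw
      obtain ⟨c, rfl⟩ := Submodule.mem_span_singleton.1 hw
      rw [map_smul, LinearMap.sub_apply, h1, hφ, sub_self, smul_zero]
    · simp only [add_sub_cancel]
      refine le_antisymm (fun w hw => ?_) (fun w hw => ?_)
      · obtain ⟨y, hy, z, hz, rfl⟩ := Submodule.mem_sup.1 (hx ▸ Submodule.mem_top : w ∈ x ⊔ _)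
        obtain ⟨c, rfl⟩ := Submodule.mem_span_singleton.1 hz
        have hy0 : f y = 0 := hxf hy
        have hc : c = 0 := by simpa [hy0, hf] using hw
        simpa [hc] using hy
      · have : f w = 0 := hxf hw
        simp [this]

-- Weisner's theorem is applied to a line and `⊤`: besides `⊤`, the sum runs over the hyperplanes
-- avoiding the line, and below each lies the subspace lattice of dimension `m`.
open scoped Classical in
theorem moebiusNumber_submodule_succ {K V : Type*} [Field K] [Finite K] [AddCommGroup V]
    [Module K V] [Finite V] {m : ℕ} (hV : Module.finrank K V = m + 1) :
    moebiusNumber (Submodule K V) =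
      -(Nat.card K ^ m : ℕ) * moebiusNumber (Submodule K (Fin m → K)) := by
  have := Fintype.ofFinite (Submodule K V)
  obtain ⟨f, hf⟩ := exists_isMoebius (Submodule K V)
  have : Nontrivial V := Module.nontrivial_of_finrank_pos (R := K) (by omega)
  obtain ⟨v, hv⟩ := exists_ne (0 : V)
  have h : moebiusNumber (Submodule K V) +
      ∑ x ∈ ({x | x ⊔ Submodule.span K {v} = ⊤} : Finset (Submodule K V)).erase ⊤, f x = 0 := by
    rw [← hf.top_eq, add_sum_erase _ _ (by simp)]
    convert hf.sum_sup_eq (a := Submodule.span K {v}) (by simpa using hv) ⊤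
  have h2 : ∀ x ∈ ({x | x ⊔ Submodule.span K {v} = ⊤} : Finset (Submodule K V)).erase ⊤,
      f x = moebiusNumber (Submodule K (Fin m → K)) := by
    intro x hx
    simp only [mem_erase, mem_filter, mem_univ, true_and] at hx
    have hvx : v ∉ x := fun h => hx.1 (by
      rw [← hx.2, eq_comm, sup_eq_left]; simpa using h)
    have hc : IsCompl x (Submodule.span K {v}) := by
      refine IsCompl.of_eq ?_ hx.2
      rw [← disjoint_iff]
      exact (Submodule.disjoint_span_singleton' hv).2 hvx
    have hr := Submodule.finrank_add_eq_of_isCompl hc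
    rw [finrank_span_singleton hv, hV] at hr
    have e : x ≃ₗ[K] (Fin m → K) := LinearEquiv.ofFinrankEq _ _ (by simpa using hr)
    rw [hf.apply_eq, ← moebiusNumber_congr (Submodule.mapIic x),
      moebiusNumber_congr (Submodule.orderIsoMapComap e)]
  rw [sum_congr rfl h2, sum_const, nsmul_eq_mul] at h
  have h3 : (({x | x ⊔ Submodule.span K {v} = ⊤} : Finset (Submodule K V)).erase ⊤).card =
      Nat.card K ^ m := by
    rw [← card_hyperplanes_not_containing hV hv, Nat.card_eq_fintype_card,
      Fintype.card_subtype]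
    congr 1
    ext x
    simp [and_comm]
  rw [h3] at h
  linarith

theorem moebiusNumber_submodule_pi (K : Type*) [Field K] [Finite K] (j : ℕ) :
    (moebiusNumber (Submodule K (Fin j → K)) : ℚ) =
      glCard (Nat.card K) j * qCoeff (Nat.card K) j := by
  have hQ : (1 : ℚ) < Nat.card K := by exact_mod_cast Finite.one_lt_card
  induction j with
  | zero => rw [moebiusNumber_of_subsingleton]; simp [glCard, qCoeff]
  | succ j ih =>
    rw [moebiusNumber_submodule_succ (m := j) (by simp), Int.cast_mul, ih, glCard_succ]
    have := qCoeff_succ hQ j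
    push_cast
    linear_combination -(Nat.card K : ℚ) ^ j * glCard (Nat.card K) j * this

end GeneralLinear

/-! ### Representations on a fixed vector space. -/

section RepMod

variable {F A V : Type*} [Field F] [CommRing A] [Algebra F A] [AddCommGroup V] [Module F V]

/-- The `A`-module with underlying vector space `V` given by a homomorphism `A → End V`. -/
def RepMod (_ρ : A →ₐ[F] Module.End F V) : Type _ := V

variable (ρ : A →ₐ[F] Module.End F V)

instance : AddCommGroup (RepMod ρ) := inferInstanceAs (AddCommGroup V)

instance : Module F (RepMod ρ) := inferInstanceAs (Module F V)

instance : Module A (RepMod ρ) := Module.compHom V ρ.toRingHom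

instance [Finite V] : Finite (RepMod ρ) := inferInstanceAs (Finite V)

instance [Module.Finite F V] : Module.Finite F (RepMod ρ) := inferInstanceAs (Module.Finite F V)

theorem RepMod.smul_def (a : A) (x : RepMod ρ) : a • x = (ρ a (x : V) : V) := rfl

instance : IsScalarTower F A (RepMod ρ) where
  smul_assoc c a x := by
    rw [RepMod.smul_def, RepMod.smul_def, map_smul]
    rfl

/-- The identity map from a vector space to the `A`-module structure on it. -/
def RepMod.of : V ≃ₗ[F] RepMod ρ := LinearEquiv.refl F V

theorem RepMod.smul_of (a : A) (x : V) : a • RepMod.of ρ x = RepMod.of ρ (ρ a x) := rfl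

theorem RepMod.finrank_eq : Module.finrank F (RepMod ρ) = Module.finrank F V := rfl

variable {M : Type*} [AddCommGroup M] [Module F M] [Module A M] [IsScalarTower F A M]

/-- The module structure transported along a linear equivalence. -/
noncomputable def transportRep (e : V ≃ₗ[F] M) : A →ₐ[F] Module.End F V :=
  (e.symm.conjAlgEquiv F).toAlgHom.comp (Algebra.lsmul F F M)

theorem apply_transportRep (e : V ≃ₗ[F] M) (a : A) (x : V) :
    e (transportRep e a x) = a • e x := by
  simp [transportRep, LinearEquiv.conjAlgEquiv_apply]

theorem eq_transportRep_iff {e : V ≃ₗ[F] M} :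
    ρ = transportRep e ↔ ∀ a x, e (ρ a x) = a • e x := by
  refine ⟨by rintro rfl; exact apply_transportRep e, fun h => ?_⟩
  ext a x
  exact e.injective ((h a x).trans (apply_transportRep e a x).symm)

variable {ρ}

/-- A linear equivalence compatible with the actions of `A`, as an `A`-linear equivalence. -/
def RepMod.linearEquiv (e : V ≃ₗ[F] M) (h : ∀ a x, e (ρ a x) = a • e x) : RepMod ρ ≃ₗ[A] M :=
  { e with map_smul' := h }

theorem finite_algHom_of_finiteType (F A B : Type*) [CommSemiring F] [Semiring A] [Algebra F A]
    [Semiring B] [Algebra F B] [Finite B] [Algebra.FiniteType F A] : Finite (A →ₐ[F] B) := by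
  obtain ⟨s, hs⟩ := (Algebra.FiniteType.out : (⊤ : Subalgebra F A).FG)
  refine Finite.of_injective (fun (φ : A →ₐ[F] B) (x : s) => φ x) fun φ ψ h => ?_
  exact AlgHom.ext_of_adjoin_eq_top hs fun x hx => congrFun h ⟨x, hx⟩

end RepMod

/-! ### Splitting off the part of a module killed by an ideal. -/

section PrimaryPart

variable {A M : Type*} [CommRing A] [AddCommGroup M] [Module A M] {m : Ideal A}

/-- Nakayama's lemma. The element `r` acts as a projection: it is the identity on `N` and kills
everything that `m` kills. -/
theorem exists_mem_smul_eq_self [Finite M] {N : Submodule A M} (h : N ≤ m • N) :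
    ∃ r ∈ m, ∀ x ∈ N, r • x = x := by
  have : Module.Finite A M := inferInstance
  have hN : N.FG := Submodule.fg_def.2 ⟨N, Set.toFinite _, by simp⟩
  obtain ⟨r, hr, h0⟩ := Submodule.exists_sub_one_mem_and_smul_eq_zero_of_fg_of_le_smul m N hN h
  refine ⟨1 - r, by simpa using m.neg_mem hr, fun x hx => ?_⟩
  rw [sub_smul, h0 x hx, one_smul, sub_zero]

/-- If the Möbius number of the submodule lattice is nonzero, then the module is the direct sum
of the part killed by `m` and the multiples of `m`. -/
theorem isCompl_torsionBySet_smul_top [Finite M] (h : moebiusNumber (Submodule A M) ≠ 0)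
    (m : Ideal A) : IsCompl (Submodule.torsionBySet A M m) (m • (⊤ : Submodule A M)) := by
  -- For a complement `C` of `mM`, `mC` lies in `C ∩ mM = 0`. So `C` is killed by `m`, and `mM =
  -- m(mM)`.
  obtain ⟨C, hC⟩ := exists_isCompl_of_moebiusNumber_ne_zero h (m • (⊤ : Submodule A M))
  have hmC : m • C = ⊥ := by
    rw [eq_bot_iff, ← hC.inf_eq_bot]
    exact le_inf (smul_mono_right _ le_top) Submodule.smul_le_right
  have hCt : C ≤ Submodule.torsionBySet A M m := by
    intro c hc
    rw [Submodule.mem_torsionBySet_iff]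
    rintro ⟨a, ha⟩
    have : a • c ∈ m • C := Submodule.smul_mem_smul ha hc
    rwa [hmC, Submodule.mem_bot] at this
  have hmm : m • (⊤ : Submodule A M) ≤ m • (m • (⊤ : Submodule A M)) := by
    nth_rw 1 [← hC.sup_eq_top]
    rw [Submodule.smul_sup, hmC, sup_bot_eq]
  obtain ⟨r, hr, h1⟩ := exists_mem_smul_eq_self hmm
  refine IsCompl.of_eq ?_ ?_
  · rw [eq_bot_iff]
    rintro x ⟨hx, hx'⟩
    rw [Submodule.mem_bot, ← h1 x hx']
    exact (Submodule.mem_torsionBySet_iff _ _).1 hx ⟨r, hr⟩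
  · refine eq_top_iff.2 (hC.sup_eq_top.ge.trans ?_)
    rw [sup_comm]
    exact sup_le_sup_right hCt _

variable {M₁ M₂ : Type*} [AddCommGroup M₁] [Module A M₁] [AddCommGroup M₂] [Module A M₂]
  [Finite M₂]

/-- Some `r ∈ m` acts as `0` on `M₁` and as `1` on `M₂`, so every submodule of the product is itself
a product. -/
theorem moebiusNumber_submodule_prod [Finite M₁] (h₁ : Module.IsTorsionBySet A M₁ m)
    (h₂ : m • (⊤ : Submodule A M₂) = ⊤) :
    moebiusNumber (Submodule A (M₁ × M₂)) =
      moebiusNumber (Submodule A M₁) * moebiusNumber (Submodule A M₂) := by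
  rw [← moebiusNumber_prod]
  obtain ⟨r, hr, h1⟩ := exists_mem_smul_eq_self h₂.ge
  let f : Submodule A M₁ × Submodule A M₂ ↪o Submodule A (M₁ × M₂) :=
    OrderEmbedding.ofMapLEIff (fun N => N.1.prod N.2) fun N N' => by
      refine ⟨fun h => ⟨fun x hx => ?_, fun y hy => ?_⟩, fun h => Submodule.prod_mono h.1 h.2⟩
      · exact (h (show (x, (0 : M₂)) ∈ N.1.prod N.2 from ⟨hx, N.2.zero_mem⟩)).1
      · exact (h (show ((0 : M₁), y) ∈ N.1.prod N.2 from ⟨N.1.zero_mem, hy⟩)).2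
  refine (moebiusNumber_congr (RelIso.ofSurjective f fun N => ?_)).symm
  refine ⟨(N.comap (LinearMap.inl A M₁ M₂), N.comap (LinearMap.inr A M₁ M₂)), ?_⟩
  have hy : ∀ x y, (x, y) ∈ N → ((0 : M₁), y) ∈ N := by
    intro x y h
    have h' := N.smul_mem r h
    rwa [Prod.smul_mk, h1 y trivial, h₁ (a := ⟨r, hr⟩)] at h'
  ext ⟨x, y⟩
  constructor
  · rintro ⟨hx', hy'⟩
    simpa using N.add_mem hx' hy'
  · intro h
    refine ⟨?_, hy x y h⟩
    simpa using N.sub_mem h (hy x y h)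

theorem mem_torsionBySet_prod_iff (h₁ : Module.IsTorsionBySet A M₁ m)
    (h₂ : m • (⊤ : Submodule A M₂) = ⊤) (z : M₁ × M₂) :
    z ∈ Submodule.torsionBySet A (M₁ × M₂) m ↔ z.2 = 0 := by
  obtain ⟨r, hr, h1⟩ := exists_mem_smul_eq_self h₂.ge
  rw [Submodule.mem_torsionBySet_iff]
  constructor
  · intro h
    have := congrArg Prod.snd (h ⟨r, hr⟩)
    rw [← h1 z.2 trivial]
    exact this
  · intro h a
    ext
    · exact h₁ (a := a)
    · simp [h]

theorem mem_smul_top_prod_iff (h₁ : Module.IsTorsionBySet A M₁ m)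
    (h₂ : m • (⊤ : Submodule A M₂) = ⊤) (z : M₁ × M₂) :
    z ∈ m • (⊤ : Submodule A (M₁ × M₂)) ↔ z.1 = 0 := by
  obtain ⟨r, hr, h1⟩ := exists_mem_smul_eq_self h₂.ge
  constructor
  · intro h
    induction h using Submodule.smul_induction_on' with
    | smul a ha x _ => exact h₁ (a := ⟨a, ha⟩)
    | add x _ y _ hx hy => rw [Prod.fst_add, hx, hy, add_zero]
  · intro h
    have : z = r • z := by
      ext
      · simp [h]
      · exact (h1 z.2 trivial).symm
    rw [this]
    exact Submodule.smul_mem_smul hr trivial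

end PrimaryPart

/-! ### Modules killed by a maximal ideal, as vector spaces over the residue field. -/

section Isotypic

variable {A : Type*} [CommRing A] (m : Ideal A)

theorem isTorsionBySet_of_linearEquiv {M N : Type*} [AddCommGroup M] [Module A M]
    [AddCommGroup N] [Module A N] {m : Ideal A} (e : M ≃ₗ[A] N)
    (h : Module.IsTorsionBySet A N m) : Module.IsTorsionBySet A M m := fun x a =>
  e.injective ((e.map_smul (a : A) x).trans ((h (a := a)).trans e.map_zero.symm))

theorem exists_linearEquiv_pi_quotient [m.IsMaximal] {M : Type*} [AddCommGroup M] [Module A M]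
    [Finite M] (h : Module.IsTorsionBySet A M m) :
    ∃ j : ℕ, Nonempty (M ≃ₗ[A] (Fin j → A ⧸ m)) := by
  let := Ideal.Quotient.field m
  let := h.module
  have : IsScalarTower A (A ⧸ m) M := h.isScalarTower
  have : Module.Finite (A ⧸ m) M := inferInstance
  exact ⟨_, ⟨(Module.finBasis (A ⧸ m) M).equivFun.restrictScalars A⟩⟩

theorem moebiusNumber_submodule_pi_quotient [m.IsMaximal] [Finite (A ⧸ m)] (j : ℕ) :
    (moebiusNumber (Submodule A (Fin j → A ⧸ m)) : ℚ) =
      glCard (Nat.card (A ⧸ m)) j * qCoeff (Nat.card (A ⧸ m)) j := by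
  let := Ideal.Quotient.field m
  rw [← moebiusNumber_submodule_pi]
  congr 1
  exact (moebiusNumber_congr (Submodule.orderIsoOfAlgebraMapSurjective
    (R := A) (S := A ⧸ m) (M := Fin j → A ⧸ m) Ideal.Quotient.mk_surjective)).symm

theorem card_linearEquiv_pi_quotient [m.IsMaximal] [Finite (A ⧸ m)] (j : ℕ) :
    (Nat.card ((Fin j → A ⧸ m) ≃ₗ[A] (Fin j → A ⧸ m)) : ℚ) = glCard (Nat.card (A ⧸ m)) j := by
  let := Ideal.Quotient.field m
  rw [← card_linearEquiv_pi]
  congr 1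
  exact Nat.card_congr ⟨LinearEquiv.extendScalarsOfSurjective
    (R := A) (S := A ⧸ m) Ideal.Quotient.mk_surjective, LinearEquiv.restrictScalars A,
      fun f => rfl, fun f => rfl⟩

variable (F : Type*) [Field F] [Algebra F A]

theorem finrank_pi_quotient [Finite (A ⧸ m)] (j : ℕ) :
    Module.finrank F (Fin j → A ⧸ m) = j * Module.finrank F (A ⧸ m) := by
  have : Module.Finite F (A ⧸ m) := inferInstance
  rw [Module.finrank_pi_fintype]
  simp

/-- Two identifications with `(A ⧸ m)^j` induce the same representation exactly when they differ by
an `A`-automorphism, so the fibre is a torsor under `GL_j(A ⧸ m)`. -/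
theorem natCard_transportRep_fiber {F : Type*} [Field F] [Finite F] [Algebra F A] {m : Ideal A} [m.IsMaximal] [Finite (A ⧸ m)] {n j : ℕ}
    (hn : n = j * Module.finrank F (A ⧸ m)) {ρ : A →ₐ[F] Module.End F (Fin n → F)}
    (h : Module.IsTorsionBySet A (RepMod ρ) m) :
    (Nat.card {e : (Fin n → F) ≃ₗ[F] (Fin j → A ⧸ m) // transportRep e = ρ} : ℚ) =
      glCard (Nat.card (A ⧸ m)) j := by
  obtain ⟨i, ⟨e₀⟩⟩ := exists_linearEquiv_pi_quotient m h
  have hi := (e₀.restrictScalars F).finrank_eq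
  rw [finrank_pi_quotient, RepMod.finrank_eq, Module.finrank_fin_fun, hn] at hi
  have hd : 0 < Module.finrank F (A ⧸ m) := by
    have : Module.Finite F (A ⧸ m) := inferInstance
    exact Module.finrank_pos
  obtain rfl := Nat.eq_of_mul_eq_mul_right hd hi
  rw [← card_linearEquiv_pi_quotient]
  congr 1
  refine Nat.card_congr ⟨fun e => e₀.symm ≪≫ₗ RepMod.linearEquiv e.1
      ((eq_transportRep_iff ρ).1 e.2.symm),
    fun f => ⟨RepMod.of ρ ≪≫ₗ (e₀ ≪≫ₗ f).restrictScalars F, ?_⟩, ?_, ?_⟩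
  · rw [eq_comm, eq_transportRep_iff]
    intro a x
    simp only [LinearEquiv.trans_apply, ← RepMod.smul_of, LinearEquiv.restrictScalars_apply,
      map_smul]
  · rintro ⟨e, he⟩
    refine Subtype.ext ?_
    ext1 x
    simp only [LinearEquiv.trans_apply, LinearEquiv.restrictScalars_apply,
      LinearEquiv.symm_apply_apply]
    rfl
  · intro f
    ext1 x
    simp only [LinearEquiv.trans_apply]
    exact congrArg f (e₀.apply_symm_apply x)

end Isotypic

/-! ### Weighted sums over representations. -/

section RepSums

variable (F : Type*) {A : Type*} [Field F] [Finite F] [CommRing A] [Algebra F A]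
  [Algebra.FiniteType F A]

noncomputable instance fintypeAlgHomEnd (n : ℕ) :
    Fintype (A →ₐ[F] Module.End F (Fin n → F)) :=
  haveI : Finite (Module.End F (Fin n → F)) := DFunLike.finite _
  haveI := finite_algHom_of_finiteType F A (Module.End F (Fin n → F))
  Fintype.ofFinite _

/-- The Möbius number of the lattice of submodules of a representation. -/
noncomputable def repMoebius {F A V : Type*} [Field F] [CommRing A] [Algebra F A]
    [AddCommGroup V] [Module F V] [Finite V] (ρ : A →ₐ[F] Module.End F V) : ℚ :=
  moebiusNumber (Submodule A (RepMod ρ))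

variable (A) in
/-- The weighted count of all representations of dimension `n`. -/
noncomputable def repSum (n : ℕ) : ℚ :=
  (∑ ρ : A →ₐ[F] Module.End F (Fin n → F), repMoebius ρ) / glCard (Nat.card F) n

open scoped Classical in
/-- The weighted count of the representations of dimension `n` killed by `m`. -/
noncomputable def torsionSum (m : Ideal A) (n : ℕ) : ℚ :=
  (∑ ρ : A →ₐ[F] Module.End F (Fin n → F) with Module.IsTorsionBySet A (RepMod ρ) m,
    repMoebius ρ) / glCard (Nat.card F) n

open scoped Classical in
/-- The weighted count of the representations of dimension `n` without nonzero quotient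
killed by `m`. -/
noncomputable def coprimeSum (m : Ideal A) (n : ℕ) : ℚ :=
  (∑ ρ : A →ₐ[F] Module.End F (Fin n → F) with m • (⊤ : Submodule A (RepMod ρ)) = ⊤,
    repMoebius ρ) / glCard (Nat.card F) n

open scoped Classical in
theorem torsionSum_of_not_dvd (m : Ideal A) [m.IsMaximal] [Finite (A ⧸ m)] {n : ℕ}
    (hn : ¬ Module.finrank F (A ⧸ m) ∣ n) : torsionSum F m n = 0 := by
  rw [torsionSum, Finset.filter_eq_empty_iff.2, Finset.sum_empty, zero_div]
  intro ρ _ h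
  obtain ⟨j, ⟨e⟩⟩ := exists_linearEquiv_pi_quotient m h
  apply hn
  have := (e.restrictScalars F).finrank_eq
  rw [finrank_pi_quotient, RepMod.finrank_eq, Module.finrank_fin_fun] at this
  exact this ▸ dvd_mul_left _ _

-- The representations counted are all isomorphic to `(A ⧸ m)^j`, hence have the same Möbius number.
-- By orbit counting there are `|GL_n(F)| / |GL_j(A ⧸ m)|` of them, so both group orders cancel.
open scoped Classical in
theorem torsionSum_mul (m : Ideal A) [m.IsMaximal] [Finite (A ⧸ m)] (j : ℕ) :
    torsionSum F m (j * Module.finrank F (A ⧸ m)) = qCoeff (Nat.card (A ⧸ m)) j := by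
  have hQ : (1 : ℚ) < Nat.card (A ⧸ m) := by
    have : Nontrivial (A ⧸ m) := Ideal.Quotient.nontrivial_iff.2 (Ideal.IsMaximal.ne_top ‹_›)
    exact_mod_cast Finite.one_lt_card
  have hq : (1 : ℚ) < Nat.card F := by exact_mod_cast Finite.one_lt_card
  have : Module.Finite F (A ⧸ m) := inferInstance
  generalize hn : j * Module.finrank F (A ⧸ m) = n
  have : Finite ((Fin n → F) ≃ₗ[F] (Fin j → A ⧸ m)) := DFunLike.finite _
  have := Fintype.ofFinite ((Fin n → F) ≃ₗ[F] (Fin j → A ⧸ m))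
  have hcard : glCard (Nat.card F) n =
      (Finset.univ.filter fun ρ : A →ₐ[F] Module.End F (Fin n → F) =>
        Module.IsTorsionBySet A (RepMod ρ) m).card * glCard (Nat.card (A ⧸ m)) j := by
    rw [← card_linearEquiv_of_finrank_eq F (V := Fin n → F) (W := Fin j → A ⧸ m) (by simp)
      (by rw [finrank_pi_quotient, hn]), Nat.card_eq_fintype_card, ← Finset.card_univ,
      Finset.card_eq_sum_card_fiberwise (f := transportRep) (t := Finset.univ.filter
        fun ρ : A →ₐ[F] Module.End F (Fin n → F) => Module.IsTorsionBySet A (RepMod ρ) m),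
      Nat.cast_sum, ← nsmul_eq_mul, ← Finset.sum_const]
    · refine Finset.sum_congr rfl fun ρ hρ => ?_
      rw [← natCard_transportRep_fiber hn.symm (Finset.mem_filter.1 hρ).2,
        Nat.card_eq_fintype_card, Fintype.card_subtype]
    · intro e _
      simp only [Finset.coe_filter, Finset.mem_univ, true_and]
      refine isTorsionBySet_of_linearEquiv (RepMod.linearEquiv e (apply_transportRep e)) ?_
      intro x a
      ext i
      obtain ⟨y, hy⟩ := Ideal.Quotient.mk_surjective (x i)
      rw [Pi.smul_apply, ← hy]
      exact Ideal.Quotient.eq_zero_iff_mem.2 (m.mul_mem_right y a.2)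
  have hsum : ∀ ρ ∈ Finset.univ.filter fun ρ : A →ₐ[F] Module.End F (Fin n → F) =>
      Module.IsTorsionBySet A (RepMod ρ) m,
      repMoebius ρ = glCard (Nat.card (A ⧸ m)) j * qCoeff (Nat.card (A ⧸ m)) j := by
    intro ρ hρ
    obtain ⟨i, ⟨e₀⟩⟩ := exists_linearEquiv_pi_quotient m (Finset.mem_filter.1 hρ).2
    have hi := (e₀.restrictScalars F).finrank_eq
    rw [finrank_pi_quotient, RepMod.finrank_eq, Module.finrank_fin_fun, ← hn] at hi
    have hd : 0 < Module.finrank F (A ⧸ m) := Module.finrank_pos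
    obtain rfl := Nat.eq_of_mul_eq_mul_right hd hi
    rw [repMoebius, ← moebiusNumber_submodule_pi_quotient,
      moebiusNumber_congr (Submodule.orderIsoMapComap e₀)]
  rw [torsionSum, Finset.sum_congr rfl hsum, Finset.sum_const, nsmul_eq_mul, ← mul_assoc,
    ← hcard, mul_div_cancel_left₀ _ (glCard_ne_zero hq n)]

end RepSums

/-! ### Decompositions of one representation into its `m`-part and the rest. -/

section Decomposition

variable {F A : Type*} [Field F] [CommRing A] [Algebra F A]

/-- The data `(e, ρ₁, ρ₂)` of a decomposition of a representation `ρ` on `F ^ n` as a direct sum,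
by means of `e`, of a representation `ρ₁` on `F ^ i` killed by `m` and a representation `ρ₂` on
`F ^ j` without nonzero quotient killed by `m`. -/
structure IsPrimaryDecomposition (m : Ideal A) {n i j : ℕ}
    (ρ : A →ₐ[F] Module.End F (Fin n → F))
    (t : (((Fin i → F) × (Fin j → F)) ≃ₗ[F] (Fin n → F)) ×
      (A →ₐ[F] Module.End F (Fin i → F)) × (A →ₐ[F] Module.End F (Fin j → F))) : Prop where
  torsion : Module.IsTorsionBySet A (RepMod t.2.1) m
  smul_top : m • (⊤ : Submodule A (RepMod t.2.2)) = ⊤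
  map_smul : ∀ a x, t.1 (t.2.1 a x.1, t.2.2 a x.2) = ρ a (t.1 x)

namespace IsPrimaryDecomposition

variable {m : Ideal A} {n i j : ℕ} {ρ : A →ₐ[F] Module.End F (Fin n → F)}
  {t : (((Fin i → F) × (Fin j → F)) ≃ₗ[F] (Fin n → F)) ×
      (A →ₐ[F] Module.End F (Fin i → F)) × (A →ₐ[F] Module.End F (Fin j → F))}

/-- The isomorphism of `A`-modules given by a decomposition. -/
def linearEquiv (h : IsPrimaryDecomposition m ρ t) :
    (RepMod t.2.1 × RepMod t.2.2) ≃ₗ[A] RepMod ρ :=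
  { t.1 with map_smul' := h.map_smul }

theorem repMoebius_eq [Finite F] (h : IsPrimaryDecomposition m ρ t) :
    repMoebius ρ = repMoebius t.2.1 * repMoebius t.2.2 := by
  rw [repMoebius, repMoebius, repMoebius, ← Int.cast_mul,
    ← moebiusNumber_submodule_prod h.torsion h.smul_top,
    moebiusNumber_congr (Submodule.orderIsoMapComap h.linearEquiv)]

theorem mem_torsionBySet_iff [Finite F] (h : IsPrimaryDecomposition m ρ t)
    (z : RepMod t.2.1 × RepMod t.2.2) :
    h.linearEquiv z ∈ Submodule.torsionBySet A (RepMod ρ) m ↔ z.2 = 0 := by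
  rw [← mem_torsionBySet_prod_iff h.torsion h.smul_top, Submodule.mem_torsionBySet_iff,
    Submodule.mem_torsionBySet_iff]
  refine forall_congr' fun a => ?_
  rw [← _root_.map_smul h.linearEquiv (a : A) z, LinearEquiv.map_eq_zero_iff]

theorem mem_smul_top_iff [Finite F] (h : IsPrimaryDecomposition m ρ t)
    (z : RepMod t.2.1 × RepMod t.2.2) :
    h.linearEquiv z ∈ m • (⊤ : Submodule A (RepMod ρ)) ↔ z.1 = 0 := by
  rw [← mem_smul_top_prod_iff h.torsion h.smul_top,
    show m • (⊤ : Submodule A (RepMod ρ)) =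
      (m • (⊤ : Submodule A (RepMod t.2.1 × RepMod t.2.2))).map h.linearEquiv.toLinearMap by
        rw [Submodule.map_smul'', Submodule.map_top, LinearEquiv.range]]
  exact ⟨fun ⟨y, hy, hyz⟩ => h.linearEquiv.injective hyz ▸ hy, fun hz => ⟨z, hz, rfl⟩⟩

/-- The two summands of any decomposition are forced to be `M[m]` and `mM`; only the bases are free.
-/
theorem exists_linearEquiv [Finite F] (h : IsPrimaryDecomposition m ρ t) :
    ∃ (e₁ : (Fin i → F) ≃ₗ[F] Submodule.torsionBySet A (RepMod ρ) m)
      (e₂ : (Fin j → F) ≃ₗ[F] (m • ⊤ : Submodule A (RepMod ρ))),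
      ∀ x y, RepMod.of ρ (t.1 (x, y)) = e₁ x + e₂ y := by
  let f₁ : (Fin i → F) →ₗ[F] (Submodule.torsionBySet A (RepMod ρ) m) :=
    { toFun := fun x => ⟨h.linearEquiv (x, 0), (h.mem_torsionBySet_iff (x, 0)).2 rfl⟩
      map_add' := fun x y => Subtype.ext
        ((congrArg t.1 (by simp : (x + y, (0 : Fin j → F)) = (x, 0) + (y, 0))).trans
          (t.1.map_add (x, 0) (y, 0)))
      map_smul' := fun c x => Subtype.ext
        ((congrArg t.1 (by simp : (c • x, (0 : Fin j → F)) = c • (x, 0))).trans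
          (t.1.map_smul c (x, 0))) }
  let f₂ : (Fin j → F) →ₗ[F] (m • ⊤ : Submodule A (RepMod ρ)) :=
    { toFun := fun y => ⟨h.linearEquiv (0, y), (h.mem_smul_top_iff (0, y)).2 rfl⟩
      map_add' := fun x y => Subtype.ext
        ((congrArg t.1 (by simp : ((0 : Fin i → F), x + y) = (0, x) + (0, y))).trans
          (t.1.map_add (0, x) (0, y)))
      map_smul' := fun c x => Subtype.ext
        ((congrArg t.1 (by simp : ((0 : Fin i → F), c • x) = c • (0, x))).trans
          (t.1.map_smul c (0, x))) }
  refine ⟨LinearEquiv.ofBijective f₁ ⟨?_, ?_⟩, LinearEquiv.ofBijective f₂ ⟨?_, ?_⟩, ?_⟩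
  · intro x y hxy
    exact congrArg Prod.fst (h.linearEquiv.injective (congrArg Subtype.val hxy))
  · rintro ⟨w, hw⟩
    obtain ⟨⟨x, y⟩, rfl⟩ := h.linearEquiv.surjective w
    obtain rfl : y = 0 := (h.mem_torsionBySet_iff (x, y)).1 hw
    exact ⟨x, rfl⟩
  · intro x y hxy
    exact congrArg Prod.snd (h.linearEquiv.injective (congrArg Subtype.val hxy))
  · rintro ⟨w, hw⟩
    obtain ⟨⟨x, y⟩, rfl⟩ := h.linearEquiv.surjective w
    obtain rfl : x = 0 := (h.mem_smul_top_iff (x, y)).1 hw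
    exact ⟨y, rfl⟩
  · intro x y
    exact (congrArg t.1 (by simp : (x, y) = (x, 0) + (0, y))).trans (t.1.map_add (x, 0) (0, y))

end IsPrimaryDecomposition

theorem smul_top_eq_top_of_linearEquiv {M N : Type*} [AddCommGroup M] [Module A M]
    [AddCommGroup N] [Module A N] {m : Ideal A} (e : M ≃ₗ[A] N)
    (h : m • (⊤ : Submodule A N) = ⊤) : m • (⊤ : Submodule A M) = ⊤ := by
  apply Submodule.map_injective_of_injective (f := e.toLinearMap) e.injective
  rw [Submodule.map_smul'', Submodule.map_top, LinearEquiv.range, h]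

theorem smul_top_smul_top_eq_top {M : Type*} [AddCommGroup M] [Module A M] {m : Ideal A}
    (h : IsCompl (Submodule.torsionBySet A M m) (m • (⊤ : Submodule A M))) :
    m • (⊤ : Submodule A (m • ⊤ : Submodule A M)) = ⊤ := by
  apply Submodule.map_injective_of_injective (Submodule.subtype_injective _)
  rw [Submodule.map_smul'', Submodule.map_top, Submodule.range_subtype]
  have hm : m • Submodule.torsionBySet A M m = ⊥ := by
    rw [eq_bot_iff, Submodule.smul_le]
    intro a ha x hx
    exact (Submodule.mem_torsionBySet_iff _ _).1 hx ⟨a, ha⟩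
  nth_rw 2 [← h.sup_eq_top]
  rw [Submodule.smul_sup, hm, bot_sup_eq]

variable {m : Ideal A} {n i j : ℕ} {ρ : A →ₐ[F] Module.End F (Fin n → F)}

/-- The decomposition of a representation given by bases of its two parts. -/
noncomputable def primaryDecomposition
    (hc : IsCompl (Submodule.torsionBySet A (RepMod ρ) m) (m • (⊤ : Submodule A (RepMod ρ))))
    (e : ((Fin i → F) ≃ₗ[F] Submodule.torsionBySet A (RepMod ρ) m) ×
      ((Fin j → F) ≃ₗ[F] (m • ⊤ : Submodule A (RepMod ρ)))) :
    (((Fin i → F) × (Fin j → F)) ≃ₗ[F] (Fin n → F)) ×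
      (A →ₐ[F] Module.End F (Fin i → F)) × (A →ₐ[F] Module.End F (Fin j → F)) :=
  (e.1.prodCongr e.2 ≪≫ₗ (Submodule.prodEquivOfIsCompl _ _ hc).restrictScalars F ≪≫ₗ
    (RepMod.of ρ).symm, transportRep e.1, transportRep e.2)

theorem of_primaryDecomposition_apply
    (hc : IsCompl (Submodule.torsionBySet A (RepMod ρ) m) (m • (⊤ : Submodule A (RepMod ρ))))
    (e : ((Fin i → F) ≃ₗ[F] Submodule.torsionBySet A (RepMod ρ) m) ×
      ((Fin j → F) ≃ₗ[F] (m • ⊤ : Submodule A (RepMod ρ)))) (x y) :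
    RepMod.of ρ ((primaryDecomposition hc e).1 (x, y)) = e.1 x + e.2 y := by
  simp [primaryDecomposition]

theorem isPrimaryDecomposition_primaryDecomposition
    (hc : IsCompl (Submodule.torsionBySet A (RepMod ρ) m) (m • (⊤ : Submodule A (RepMod ρ))))
    (e : ((Fin i → F) ≃ₗ[F] Submodule.torsionBySet A (RepMod ρ) m) ×
      ((Fin j → F) ≃ₗ[F] (m • ⊤ : Submodule A (RepMod ρ)))) :
    IsPrimaryDecomposition m ρ (primaryDecomposition hc e) where
  torsion := isTorsionBySet_of_linearEquiv
    (RepMod.linearEquiv (M := Submodule.torsionBySet A (RepMod ρ) m) e.1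
      (apply_transportRep e.1)) (Submodule.torsionBySet_isTorsionBySet _)
  smul_top := smul_top_eq_top_of_linearEquiv
    (RepMod.linearEquiv (A := A) (M := (m • ⊤ : Submodule A (RepMod ρ))) e.2
      (apply_transportRep (A := A) e.2)) (smul_top_smul_top_eq_top hc)
  map_smul a x := by
    apply (RepMod.of ρ).injective
    rw [of_primaryDecomposition_apply, ← RepMod.smul_of, ← Prod.mk.eta (p := x),
      of_primaryDecomposition_apply]
    simp [primaryDecomposition, apply_transportRep]

theorem primaryDecomposition_bijective [Finite F]
    (hc : IsCompl (Submodule.torsionBySet A (RepMod ρ) m) (m • (⊤ : Submodule A (RepMod ρ)))) :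
    Function.Bijective fun e : ((Fin i → F) ≃ₗ[F] Submodule.torsionBySet A (RepMod ρ) m) ×
      ((Fin j → F) ≃ₗ[F] (m • ⊤ : Submodule A (RepMod ρ))) =>
      (⟨primaryDecomposition hc e, isPrimaryDecomposition_primaryDecomposition hc e⟩ :
        {t // IsPrimaryDecomposition m ρ t}) := by
  constructor
  · rintro ⟨e₁, e₂⟩ ⟨e₁', e₂'⟩ h
    have h' : ∀ x y, (e₁ x : RepMod ρ) + e₂ y = e₁' x + e₂' y := by
      intro x y
      have := congrArg (fun s => RepMod.of ρ (s.1.1 (x, y))) h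
      exact (of_primaryDecomposition_apply hc (e₁, e₂) x y).symm.trans
        (this.trans (of_primaryDecomposition_apply hc (e₁', e₂') x y))
    ext1
    · ext1 x
      exact Subtype.ext (by simpa using h' x 0)
    · ext1 x
      exact Subtype.ext (by simpa using h' 0 x)
  · rintro ⟨t, ht⟩
    obtain ⟨e₁, e₂, he⟩ := ht.exists_linearEquiv
    refine ⟨(e₁, e₂), Subtype.ext ?_⟩
    have key : ∀ a x y, (e₁ (t.2.1 a x) : RepMod ρ) + e₂ (t.2.2 a y) = a • (e₁ x + e₂ y) := by
      intro a x y
      rw [← he, ← he, RepMod.smul_of, ← ht.map_smul]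
    refine Prod.ext ?_ (Prod.ext ?_ ?_)
    · ext1 ⟨x, y⟩
      apply (RepMod.of ρ).injective
      rw [of_primaryDecomposition_apply, he]
    · refine ((eq_transportRep_iff _).2 fun a x => Subtype.ext ?_).symm
      simpa using key a x 0
    · refine ((eq_transportRep_iff _).2 fun a x => Subtype.ext ?_).symm
      simpa using key a 0 x

theorem sum_prod_prod_mul {X Y Z : Type*} [Fintype X] [Fintype Y] [Fintype Z] (f : Y → ℚ)
    (g : Z → ℚ) : ∑ t : X × Y × Z, f t.2.1 * g t.2.2 =
      Fintype.card X * ((∑ y, f y) * ∑ z, g z) := by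
  have h : ∑ s : Y × Z, f s.1 * g s.2 = (∑ y, f y) * ∑ z, g z := by
    rw [Fintype.sum_prod_type, Finset.sum_mul_sum]
  rw [Fintype.sum_prod_type, ← h, ← nsmul_eq_mul, ← Finset.card_univ, ← Finset.sum_const]

theorem repMoebius_mul_natCard_isPrimaryDecomposition [Finite F] (m : Ideal A) {n i j : ℕ} (hn : i + j = n)
    (ρ : A →ₐ[F] Module.End F (Fin n → F)) :
    repMoebius ρ * (Nat.card {t // IsPrimaryDecomposition (i := i) (j := j) m ρ t} : ℚ) =
      if Module.finrank F (Submodule.torsionBySet A (RepMod ρ) m) = i then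
        repMoebius ρ * (glCard (Nat.card F) i * glCard (Nat.card F) j) else 0 := by
  split_ifs with hi
  -- `M[m]` and `mM` are known to be complementary only when the Möbius number is nonzero; otherwise
  -- both sides vanish.
  · by_cases h0 : repMoebius ρ = 0
    · simp [h0]
    have hc := isCompl_torsionBySet_smul_top (M := RepMod ρ) (by
      intro h; apply h0; rw [repMoebius, h, Int.cast_zero]) m
    have hj : Module.finrank F (m • ⊤ : Submodule A (RepMod ρ)) = j := by
      have := ((Submodule.prodEquivOfIsCompl _ _ hc).restrictScalars F).finrank_eq
      rw [Module.finrank_prod, RepMod.finrank_eq, Module.finrank_fin_fun, hi] at this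
      omega
    rw [← Nat.card_congr (Equiv.ofBijective _ (primaryDecomposition_bijective hc)),
      Nat.card_prod, Nat.cast_mul, card_linearEquiv_of_finrank_eq F (n := i) (by simp) hi,
      card_linearEquiv_of_finrank_eq F (n := j) (by simp) hj]
  · have : IsEmpty {t // IsPrimaryDecomposition (i := i) (j := j) m ρ t} := by
      refine ⟨fun ⟨t, ht⟩ => hi ?_⟩
      obtain ⟨e₁, -⟩ := ht.exists_linearEquiv
      rw [← e₁.finrank_eq, Module.finrank_fin_fun]
    simp

end Decomposition

/-! ### The convolution formula. -/

section Count

variable {F A : Type*} [Field F] [Finite F] [CommRing A] [Algebra F A]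
  [Algebra.FiniteType F A]

-- Double counting of pairs of a representation `ρ` and a decomposition `(e, ρ₁, ρ₂)` of it,
-- weighted by `repMoebius ρ`. A given `ρ` of nonzero weight with `dim M[m] = i` has `|GL_i| |GL_j|`
-- decompositions; a given triple of the right type decomposes exactly one `ρ`, and there are
-- `|GL_n|` choices of `e`.
open scoped Classical in
theorem sum_repMoebius_finrank_torsion (m : Ideal A) {n i j : ℕ} (hn : i + j = n) :
    ∑ ρ : A →ₐ[F] Module.End F (Fin n → F) with
      Module.finrank F (Submodule.torsionBySet A (RepMod ρ) m) = i, repMoebius ρ =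
    glCard (Nat.card F) n * (torsionSum F m i * coprimeSum F m j) := by
  have hq : (1 : ℚ) < Nat.card F := by exact_mod_cast Finite.one_lt_card
  have : Finite (((Fin i → F) × (Fin j → F)) ≃ₗ[F] (Fin n → F)) := DFunLike.finite _
  have := Fintype.ofFinite (((Fin i → F) × (Fin j → F)) ≃ₗ[F] (Fin n → F))
  have h1 : ∑ ρ : A →ₐ[F] Module.End F (Fin n → F),
      ∑ t with IsPrimaryDecomposition (i := i) (j := j) m ρ t, repMoebius ρ =
      (∑ ρ : A →ₐ[F] Module.End F (Fin n → F) with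
      Module.finrank F (Submodule.torsionBySet A (RepMod ρ) m) = i, repMoebius ρ) *
        (glCard (Nat.card F) i * glCard (Nat.card F) j) := by
    rw [Finset.sum_mul, Finset.sum_filter]
    refine Finset.sum_congr rfl fun ρ _ => ?_
    rw [← repMoebius_mul_natCard_isPrimaryDecomposition m hn, Finset.sum_const, nsmul_eq_mul,
      mul_comm, Nat.card_eq_fintype_card, Fintype.card_subtype]
  have h2 : ∑ ρ : A →ₐ[F] Module.End F (Fin n → F),
      ∑ t with IsPrimaryDecomposition (i := i) (j := j) m ρ t, repMoebius ρ =
      ∑ t : (((Fin i → F) × (Fin j → F)) ≃ₗ[F] (Fin n → F)) ×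
        (A →ₐ[F] Module.End F (Fin i → F)) × (A →ₐ[F] Module.End F (Fin j → F)),
        (if Module.IsTorsionBySet A (RepMod t.2.1) m then repMoebius t.2.1 else 0) *
          (if m • (⊤ : Submodule A (RepMod t.2.2)) = ⊤ then repMoebius t.2.2 else 0) := by
    simp_rw [Finset.sum_filter]
    rw [Finset.sum_comm]
    refine Finset.sum_congr rfl fun t _ => ?_
    by_cases ht1 : Module.IsTorsionBySet A (RepMod t.2.1) m
    · by_cases ht2 : m • (⊤ : Submodule A (RepMod t.2.2)) = ⊤
      · rw [if_pos ht1, if_pos ht2]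
        -- The only representation decomposed by `t` is the direct sum `ρ₁ ⊕ ρ₂` transported along
        -- `e`.
        let ρ₀ : A →ₐ[F] Module.End F (Fin n → F) := transportRep
          (t.1.symm ≪≫ₗ (RepMod.of t.2.1).prodCongr (RepMod.of t.2.2))
        have hiff : ∀ ρ, IsPrimaryDecomposition m ρ t ↔ ρ = ρ₀ := by
          intro ρ
          rw [eq_transportRep_iff]
          constructor
          · intro h a x
            obtain ⟨y, rfl⟩ := t.1.surjective x
            rw [← h.map_smul]
            simp [RepMod.smul_of]
          · intro h
            refine ⟨ht1, ht2, fun a x => ?_⟩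
            have := h a (t.1 x)
            simp only [LinearEquiv.trans_apply, LinearEquiv.symm_apply_apply] at this
            apply t.1.symm.injective
            rw [LinearEquiv.symm_apply_apply]
            exact this.symm
        simp_rw [hiff]
        rw [Finset.sum_ite_eq' Finset.univ ρ₀, if_pos (Finset.mem_univ _)]
        exact ((hiff ρ₀).2 rfl).repMoebius_eq
      · rw [if_neg ht2, mul_zero]
        exact Finset.sum_eq_zero fun ρ _ => if_neg fun h => ht2 h.smul_top
    · rw [if_neg ht1, zero_mul]
      exact Finset.sum_eq_zero fun ρ _ => if_neg fun h => ht1 h.torsion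
  have h3 : (Fintype.card (((Fin i → F) × (Fin j → F)) ≃ₗ[F] (Fin n → F)) : ℚ) =
      glCard (Nat.card F) n := by
    rw [← Nat.card_eq_fintype_card]
    exact card_linearEquiv_of_finrank_eq F (by simpa using hn) (by simp)
  replace h2 := (h1.symm.trans h2).trans (sum_prod_prod_mul
    (fun ρ₁ : A →ₐ[F] Module.End F (Fin i → F) =>
      if Module.IsTorsionBySet A (RepMod ρ₁) m then repMoebius ρ₁ else 0)
    (fun ρ₂ : A →ₐ[F] Module.End F (Fin j → F) =>
      if m • (⊤ : Submodule A (RepMod ρ₂)) = ⊤ then repMoebius ρ₂ else 0))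
  rw [h3] at h2
  have hi := glCard_ne_zero hq i
  have hj := glCard_ne_zero hq j
  rw [torsionSum, coprimeSum, Finset.sum_filter (s := Finset.univ (α := A →ₐ[F] Module.End F
    (Fin i → F))), Finset.sum_filter (s := Finset.univ (α := A →ₐ[F] Module.End F
    (Fin j → F)))]
  field_simp
  linear_combination h2

open scoped Classical in
theorem sum_mul_repMoebius (m : Ideal A) (n : ℕ) (f : ℕ → ℚ) :
    ∑ ρ : A →ₐ[F] Module.End F (Fin n → F),
      f (Module.finrank F (Submodule.torsionBySet A (RepMod ρ) m)) * repMoebius ρ =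
    glCard (Nat.card F) n *
      ∑ i ∈ Finset.range (n + 1), f i * torsionSum F m i * coprimeSum F m (n - i) := by
  rw [Finset.mul_sum, ← Finset.sum_fiberwise_of_maps_to (t := Finset.range (n + 1))
      (g := fun ρ => Module.finrank F (Submodule.torsionBySet A (RepMod ρ) m))]
  · refine Finset.sum_congr rfl fun i hi => ?_
    rw [mul_assoc, mul_left_comm, ← sum_repMoebius_finrank_torsion m (n := n) (by
      have := Finset.mem_range.1 hi; omega), Finset.mul_sum]
    refine Finset.sum_congr rfl fun ρ hρ => ?_
    rw [(Finset.mem_filter.1 hρ).2]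
  · intro ρ _
    rw [Finset.mem_range, Nat.lt_succ_iff]
    refine (Submodule.finrank_le
      ((Submodule.torsionBySet A (RepMod ρ) m).restrictScalars F)).trans ?_
    rw [RepMod.finrank_eq, Module.finrank_fin_fun]

end Count

/-! ### Semisimple modules, maximal ideals and points over finite fields. -/

section Semisimple

variable {F A M : Type*} [Field F] [CommRing A] [Algebra F A] [AddCommGroup M] [Module F M]
  [Module A M] [IsScalarTower F A M] [Finite M]

open scoped Classical in
/-- A finite module whose submodule lattice has nonzero Möbius number is the direct sum of the
parts killed by the maximal ideals. -/
theorem finrank_eq_sum_torsionBySet (h : moebiusNumber (Submodule A M) ≠ 0)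
    (S : Finset (Ideal A)) (hmax : ∀ m ∈ S, m.IsMaximal)
    (hS : ∀ m : Ideal A, m.IsMaximal → Submodule.torsionBySet A M m ≠ ⊥ → m ∈ S) :
    Module.finrank F M = ∑ m ∈ S, Module.finrank F (Submodule.torsionBySet A M m) := by
  have hp : (S : Set (Ideal A)).Pairwise fun i j => i ⊔ j = ⊤ := fun i hi j hj hij =>
    (hmax i hi).coprime_of_ne (hmax j hj) hij
  have hsup : ⨆ m ∈ S, Submodule.torsionBySet A M m = ⊤ := by
    -- A nonzero complement of the sum would contain a simple module; that module is killed by its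
    -- maximal annihilator, so it already lies in the sum.
    obtain ⟨C, hC⟩ := exists_isCompl_of_moebiusNumber_ne_zero h
      (⨆ m ∈ S, Submodule.torsionBySet A M m)
    rcases eq_bot_or_exists_atom_le C with h0 | ⟨N, hN, hNC⟩
    · rw [← hC.sup_eq_top, h0, sup_bot_eq]
    · exfalso
      have hs : IsSimpleModule A N := isSimpleModule_iff_isAtom.2 hN
      have hle : N ≤ Submodule.torsionBySet A M (Module.annihilator A N : Ideal A) := by
        intro x hx
        rw [Submodule.mem_torsionBySet_iff]
        rintro ⟨a, ha⟩
        exact congrArg Subtype.val (Module.mem_annihilator.1 ha ⟨x, hx⟩)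
      have hmem := hS _ IsSimpleModule.annihilator_isMaximal
        (ne_bot_of_le_ne_bot hN.1 hle)
      apply hN.1
      rw [eq_bot_iff, ← hC.inf_eq_bot]
      exact le_inf (hle.trans (le_biSup (fun m : Ideal A => Submodule.torsionBySet A M m) hmem)) hNC
  have htor : Module.IsTorsionBySet A M (⨅ m ∈ S, m : Ideal A) := by
    rw [Module.isTorsionBySet_iff_torsionBySet_eq_top,
      ← Submodule.iSup_torsionBySet_ideal_eq_torsionBySet_iInf hp, hsup]
  have hint := Submodule.torsionBySet_isInternal hp htor
  have e := (LinearEquiv.ofBijective (DirectSum.coeLinearMap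
    fun m : S => Submodule.torsionBySet A M (m : Ideal A)) hint).restrictScalars F
  have : Module.Finite F M := inferInstance
  rw [← e.finrank_eq, Module.finrank_directSum, Finset.sum_coe_sort S
    (fun m => Module.finrank F (Submodule.torsionBySet A M m))]

theorem finite_quotient_of_torsionBySet_ne_bot {m : Ideal A} (hm : m.IsMaximal)
    (h : Submodule.torsionBySet A M m ≠ ⊥) :
    Finite (A ⧸ m) ∧ Module.finrank F (A ⧸ m) ≤ Module.finrank F M := by
  obtain ⟨x, hx, hx0⟩ := Submodule.exists_mem_ne_zero_of_ne_bot h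
  have hker : LinearMap.ker (LinearMap.toSpanSingleton A M x) = m := by
    refine (hm.eq_of_le ?_ ?_).symm
    · intro h1
      have : (1 : A) ∈ LinearMap.ker (LinearMap.toSpanSingleton A M x) := h1 ▸ Submodule.mem_top
      apply hx0
      simpa using this
    · intro a ha
      exact (Submodule.mem_torsionBySet_iff _ _).1 hx ⟨a, ha⟩
  let f : (A ⧸ m) →ₗ[A] M := m.liftQ (LinearMap.toSpanSingleton A M x) hker.ge
  have hf : Function.Injective f := by
    rw [← LinearMap.ker_eq_bot]
    exact Submodule.ker_liftQ_eq_bot _ _ _ hker.le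
  have hfin : Finite (A ⧸ m) := Finite.of_injective f hf
  exact ⟨hfin, LinearMap.finrank_le_finrank_of_injective (f := f.restrictScalars F) hf⟩

theorem finrank_quotient_ker_dvd {F A L : Type*} [Field F] [CommRing A] [Algebra F A] [Field L] [Finite L] [Algebra F L]
    (φ : A →ₐ[F] L) : (RingHom.ker φ).IsMaximal ∧ Finite (A ⧸ RingHom.ker φ) ∧
      Module.finrank F (A ⧸ RingHom.ker φ) ∣ Module.finrank F L := by
  have hinj : Function.Injective (Ideal.kerLiftAlg φ) := Ideal.kerLiftAlg_injective φ
  have hfin : Finite (A ⧸ RingHom.ker φ) := Finite.of_injective _ hinj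
  have hp : (RingHom.ker φ).IsPrime := RingHom.ker_isPrime φ
  have hmax : (RingHom.ker φ).IsMaximal :=
    Ideal.Quotient.maximal_of_isField _ (Finite.isField_of_domain _)
  refine ⟨hmax, hfin, ?_⟩
  let := Ideal.Quotient.field (RingHom.ker φ)
  let := (Ideal.kerLiftAlg φ).toRingHom.toAlgebra
  have : IsScalarTower F (A ⧸ RingHom.ker φ) L :=
    IsScalarTower.of_algebraMap_eq fun c => ((Ideal.kerLiftAlg φ).commutes c).symm
  exact ⟨_, (Module.finrank_mul_finrank F (A ⧸ RingHom.ker φ) L).symm⟩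

/-- Points with kernel `m` are embeddings of the residue field in `L`; a finite field of degree `d`
has `d` of them once `d` divides the degree of `L`. -/
theorem natCard_algHom_ker_eq {F A L : Type*} [Field F] [CommRing A] [Algebra F A] [Field L] [Finite L] [Algebra F L] (m : Ideal A)
    [m.IsMaximal] (h : Module.finrank F (A ⧸ m) ∣ Module.finrank F L) :
    Nat.card {φ : A →ₐ[F] L // RingHom.ker φ = m} = Module.finrank F (A ⧸ m) := by
  let := Ideal.Quotient.field m
  rw [← FiniteField.natCard_algHom_of_finrank_dvd (F := F) (K := A ⧸ m) (L := L) h]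
  refine Nat.card_congr ⟨fun φ => Ideal.Quotient.liftₐ m φ.1 fun a ha => by
      rwa [← φ.2, RingHom.mem_ker] at ha,
    fun ψ => ⟨ψ.comp (Ideal.Quotient.mkₐ F m), ?_⟩, ?_, ?_⟩
  · ext a
    rw [RingHom.mem_ker, AlgHom.comp_apply, map_eq_zero_iff ψ ψ.toRingHom.injective]
    exact Ideal.Quotient.eq_zero_iff_mem
  · intro φ
    exact Subtype.ext (AlgHom.ext fun a => rfl)
  · intro ψ
    ext a
    obtain ⟨a, rfl⟩ := Ideal.Quotient.mk_surjective a
    rfl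

end Semisimple

/-! ### The recursion for the weighted sums in terms of point counts. -/

section Recursion

variable {F A : Type*} [Field F] [Finite F] [CommRing A] [Algebra F A]

/-- The maximal ideals with residue field of degree at most `n`. -/
def maximalIdealsOfDegreeLE (F A : Type*) [Field F] [CommRing A] [Algebra F A] (n : ℕ) :
    Set (Ideal A) :=
  {m | m.IsMaximal ∧ Finite (A ⧸ m) ∧ Module.finrank F (A ⧸ m) ≤ n}

theorem exists_field_finrank_eq (F : Type*) [Field F] [Finite F] {n : ℕ} (hn : n ≠ 0) :
    ∃ (L : Type) (_ : Field L) (_ : Algebra F L), Finite L ∧ Module.finrank F L = n := by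
  obtain ⟨p, hp⟩ := CharP.exists F
  have : Fact p.Prime := ⟨CharP.char_is_prime F p⟩
  have : NeZero n := ⟨hn⟩
  exact ⟨FiniteField.Extension F p n, inferInstance, inferInstance, inferInstance,
    FiniteField.finrank_extension F p n⟩

variable [Algebra.FiniteType F A]

variable (F A) in
theorem finite_maximalIdealsOfDegreeLE (n : ℕ) : (maximalIdealsOfDegreeLE F A n).Finite := by
  -- Every degree up to `n` divides `n!`, so this one field receives all residue fields in question,
  -- and `A` has finitely many points in it.
  obtain ⟨L, _, _, _, hL⟩ := exists_field_finrank_eq F (Nat.factorial_ne_zero n)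
  have := finite_algHom_of_finiteType F A L
  refine (Set.finite_range fun φ : A →ₐ[F] L => RingHom.ker φ).subset ?_
  rintro m ⟨hm, hfin, hle⟩
  have : Module.Finite F (A ⧸ m) := inferInstance
  have hpos : 0 < Module.finrank F (A ⧸ m) := Module.finrank_pos
  have hcard := natCard_algHom_ker_eq (F := F) (L := L) m
    (hL ▸ Nat.dvd_factorial hpos hle)
  obtain ⟨φ, hφ⟩ := (Nat.card_pos_iff.1 (hcard ▸ hpos)).1
  exact ⟨φ, hφ⟩

open scoped Classical in
theorem sum_finrank_quotient_eq {L : Type*} [Field L] [Finite L] [Algebra F L] {n : ℕ}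
    (hLn : Module.finrank F L ≤ n) (hL : Module.finrank F L ≠ 0) :
    ∑ m ∈ (finite_maximalIdealsOfDegreeLE F A n).toFinset,
      (if Module.finrank F (A ⧸ m) ∣ Module.finrank F L then Module.finrank F (A ⧸ m) else 0) =
      Nat.card (A →ₐ[F] L) := by
  have := finite_algHom_of_finiteType F A L
  have := Fintype.ofFinite (A →ₐ[F] L)
  rw [Nat.card_eq_fintype_card, ← Finset.card_univ,
    Finset.card_eq_sum_card_fiberwise (f := fun φ : A →ₐ[F] L => RingHom.ker φ)
      (t := (finite_maximalIdealsOfDegreeLE F A n).toFinset)]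
  · refine Finset.sum_congr rfl fun m hm => ?_
    obtain ⟨hm, hfin, hle⟩ := (Set.Finite.mem_toFinset _).1 hm
    split_ifs with hd
    · rw [← natCard_algHom_ker_eq m hd, Nat.card_eq_fintype_card, Fintype.card_subtype]
    · rw [eq_comm, Finset.card_eq_zero, Finset.filter_eq_empty_iff]
      rintro φ - rfl
      exact hd (finrank_quotient_ker_dvd φ).2.2
  · intro φ _
    rw [Finset.mem_coe, Set.Finite.mem_toFinset]
    obtain ⟨h1, h2, h3⟩ := finrank_quotient_ker_dvd φ
    exact ⟨h1, h2, (Nat.le_of_dvd (Nat.pos_of_ne_zero hL) h3).trans hLn⟩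

open Finset in
theorem natCast_mul_qCoeff_antidiagonal {Q : ℚ} (hQ : 1 < Q) (j : ℕ) :
    j * qCoeff Q j = -∑ p ∈ antidiagonal j, 1 / (Q ^ p.1 - 1) * qCoeff Q p.2 := by
  rw [natCast_mul_qCoeff hQ, Nat.sum_antidiagonal_eq_sum_range_succ_mk, sum_range_succ']
  -- The antidiagonal term with `p.1 = 0` is `1 / 0 = 0`, which allows the sum to include it.
  simp only [pow_zero, sub_self, div_zero, zero_mul, add_zero]
  congr 1
  refine sum_congr rfl fun i _ => ?_
  rw [show j - (i + 1) = j - 1 - i by omega]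
  ring

-- The recursion for `qCoeff` with `t` replaced by `t^d`, `d` the residue degree: `|A ⧸ m| = q^d`,
-- and differentiating in `t` produces the extra factor `d`.
open scoped Classical in
open Finset in
theorem natCast_mul_torsionSum (m : Ideal A) [m.IsMaximal] [Finite (A ⧸ m)] (i : ℕ) :
    i * torsionSum F m i = -∑ p ∈ antidiagonal i,
      (if Module.finrank F (A ⧸ m) ∣ p.1 then (Module.finrank F (A ⧸ m) : ℚ) else 0) /
        ((Nat.card F : ℚ) ^ p.1 - 1) * torsionSum F m p.2 := by
  have : Module.Finite F (A ⧸ m) := inferInstance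
  have : Nontrivial (A ⧸ m) := Ideal.Quotient.nontrivial_iff.2 (Ideal.IsMaximal.ne_top ‹_›)
  have hd : 0 < Module.finrank F (A ⧸ m) := Module.finrank_pos
  have hQ : (1 : ℚ) < Nat.card (A ⧸ m) := by exact_mod_cast Finite.one_lt_card
  have hcard : Nat.card (A ⧸ m) = Nat.card F ^ Module.finrank F (A ⧸ m) :=
    Module.natCard_eq_pow_finrank
  have htm := torsionSum_mul F m
  have ht0 : ∀ n, ¬ Module.finrank F (A ⧸ m) ∣ n → torsionSum F m n = 0 := fun n =>
    torsionSum_of_not_dvd F m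
  generalize Module.finrank F (A ⧸ m) = d at *
  by_cases hi : d ∣ i
  · obtain ⟨j, rfl⟩ := hi
    rw [mul_comm d j, htm, Nat.cast_mul, mul_right_comm, natCast_mul_qCoeff_antidiagonal hQ,
      neg_mul, sum_mul]
    congr 1
    refine sum_of_injOn (fun p => (p.1 * d, p.2 * d)) ?_ ?_ ?_ ?_
    · rintro ⟨a, b⟩ - ⟨a', b'⟩ - h
      simpa [hd.ne'] using h
    · rintro ⟨a, b⟩ h
      simp only [mem_coe, HasAntidiagonal.mem_antidiagonal] at h ⊢
      rw [← add_mul, h]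
    · rintro ⟨a, b⟩ h h'
      rw [HasAntidiagonal.mem_antidiagonal] at h
      by_cases ha : d ∣ a
      · exfalso
        have hb : d ∣ b := by
          rw [← Nat.dvd_add_right ha]
          simp only at h
          rw [h]; exact dvd_mul_left _ _
        obtain ⟨a, rfl⟩ := ha
        obtain ⟨b, rfl⟩ := hb
        refine h' ⟨(a, b), ?_, ?_⟩
        · simp only [mem_coe, HasAntidiagonal.mem_antidiagonal] at h ⊢
          exact Nat.eq_of_mul_eq_mul_left hd (by rw [mul_add, h, mul_comm])
        · simp [mul_comm]
      · simp [ha]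
    · rintro ⟨a, b⟩ -
      simp only [htm, dvd_mul_left, if_true]
      rw [hcard]
      push_cast
      rw [← pow_mul, mul_comm d a]
      ring
  · rw [ht0 i hi, mul_zero, eq_comm, neg_eq_zero]
    refine sum_eq_zero fun p hp => ?_
    by_cases hp1 : d ∣ p.1
    · rw [ht0 p.2, mul_zero]
      intro hp2
      exact hi (HasAntidiagonal.mem_antidiagonal.1 hp ▸ dvd_add hp1 hp2)
    · simp [hp1]

theorem repSum_eq_sum (m : Ideal A) (n : ℕ) :
    repSum F A n = ∑ i ∈ Finset.range (n + 1), torsionSum F m i * coprimeSum F m (n - i) := by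
  have hq : (1 : ℚ) < Nat.card F := by exact_mod_cast Finite.one_lt_card
  have h := sum_mul_repMoebius (F := F) m n (fun _ => 1)
  simp only [one_mul] at h
  rw [repSum, h, mul_div_cancel_left₀ _ (glCard_ne_zero hq n)]

open scoped Classical in
open Finset in
theorem sum_finrank_torsion_mul_repMoebius (m : Ideal A) [m.IsMaximal] [Finite (A ⧸ m)] (n : ℕ) :
    ∑ ρ : A →ₐ[F] Module.End F (Fin n → F),
      (Module.finrank F (Submodule.torsionBySet A (RepMod ρ) m) : ℚ) * repMoebius ρ =
    -glCard (Nat.card F) n * ∑ p ∈ antidiagonal n,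
      (if Module.finrank F (A ⧸ m) ∣ p.1 then (Module.finrank F (A ⧸ m) : ℚ) else 0) /
        ((Nat.card F : ℚ) ^ p.1 - 1) * repSum F A p.2 := by
  rw [sum_mul_repMoebius m n (fun i => (i : ℚ)), neg_mul, ← mul_neg]
  congr 1
  -- The full series is `T * C`. Weighting by `dim M[m]` applies `t d/dt` to `T` alone, and since
  -- this gives `-W * T`, the weighted series is `-W` times the full one.
  let T : PowerSeries ℚ := PowerSeries.mk (torsionSum F m)
  let C : PowerSeries ℚ := PowerSeries.mk (coprimeSum F m)
  let W : PowerSeries ℚ := PowerSeries.mk fun k =>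
    (if Module.finrank F (A ⧸ m) ∣ k then (Module.finrank F (A ⧸ m) : ℚ) else 0) /
        ((Nat.card F : ℚ) ^ k - 1)
  have hT : PowerSeries.mk (fun i => (i : ℚ) * torsionSum F m i) = -(W * T) := by
    ext i
    rw [PowerSeries.coeff_mk, natCast_mul_torsionSum, map_neg, PowerSeries.coeff_mul]
    simp [W, T]
  have hA : PowerSeries.mk (repSum F A) = T * C := by
    ext i
    rw [PowerSeries.coeff_mk, repSum_eq_sum m, PowerSeries.coeff_mul,
      Nat.sum_antidiagonal_eq_sum_range_succ_mk]
    simp [T, C]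
  have h := congrArg (PowerSeries.coeff n) (congrArg (· * C) hT)
  simp only [neg_mul, mul_assoc, ← hA, map_neg, PowerSeries.coeff_mul, PowerSeries.coeff_mk,
    W, C] at h
  rw [← h, Nat.sum_antidiagonal_eq_sum_range_succ_mk]
  exact sum_congr rfl fun i _ => by ring

-- On representations of nonzero weight, `n` is the sum of the `dim M[m]`. Summing the previous
-- formula over `m`, the degrees dividing `k` add up to the number of points in the extension of
-- degree `k`.
open scoped Classical in
open Finset in
theorem natCast_mul_repSum (N : ℕ → ℕ)
    (hN : ∀ (L : Type) [Field L] [Finite L] [Algebra F L],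
      Nat.card (A →ₐ[F] L) = N (Module.finrank F L)) (n : ℕ) :
    n * repSum F A n =
      -∑ p ∈ antidiagonal n, N p.1 / ((Nat.card F : ℚ) ^ p.1 - 1) * repSum F A p.2 := by
  have hq : (1 : ℚ) < Nat.card F := by exact_mod_cast Finite.one_lt_card
  let S := (finite_maximalIdealsOfDegreeLE F A n).toFinset
  have hS : ∀ m ∈ S, m.IsMaximal ∧ Finite (A ⧸ m) ∧ Module.finrank F (A ⧸ m) ≤ n :=
    fun m hm => (Set.Finite.mem_toFinset (finite_maximalIdealsOfDegreeLE F A n)).1 hm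
  have h1 : ∑ ρ : A →ₐ[F] Module.End F (Fin n → F), (n : ℚ) * repMoebius ρ =
      ∑ m ∈ S, ∑ ρ : A →ₐ[F] Module.End F (Fin n → F),
        (Module.finrank F (Submodule.torsionBySet A (RepMod ρ) m) : ℚ) * repMoebius ρ := by
    rw [sum_comm]
    refine sum_congr rfl fun ρ _ => ?_
    by_cases h0 : moebiusNumber (Submodule A (RepMod ρ)) = 0
    · simp [repMoebius, h0]
    · rw [← sum_mul, ← Nat.cast_sum, ← finrank_eq_sum_torsionBySet h0 S (fun m hm => (hS m hm).1),
        RepMod.finrank_eq, Module.finrank_fin_fun]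
      intro m hm hne
      obtain ⟨h2, h3⟩ := finite_quotient_of_torsionBySet_ne_bot (F := F) hm hne
      rw [RepMod.finrank_eq, Module.finrank_fin_fun] at h3
      exact (Set.Finite.mem_toFinset _).2 ⟨hm, h2, h3⟩
  have h2 : ∀ m ∈ S, ∑ ρ : A →ₐ[F] Module.End F (Fin n → F),
      (Module.finrank F (Submodule.torsionBySet A (RepMod ρ) m) : ℚ) * repMoebius ρ =
      -glCard (Nat.card F) n * ∑ p ∈ antidiagonal n,
      (if Module.finrank F (A ⧸ m) ∣ p.1 then (Module.finrank F (A ⧸ m) : ℚ) else 0) /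
        ((Nat.card F : ℚ) ^ p.1 - 1) * repSum F A p.2 := by
    intro m hm
    obtain ⟨h3, h4, -⟩ := hS m hm
    exact sum_finrank_torsion_mul_repMoebius m n
  have h3 : ∀ p ∈ antidiagonal n, ∑ m ∈ S,
      (if Module.finrank F (A ⧸ m) ∣ p.1 then (Module.finrank F (A ⧸ m) : ℚ) else 0) /
        ((Nat.card F : ℚ) ^ p.1 - 1) * repSum F A p.2 =
      N p.1 / ((Nat.card F : ℚ) ^ p.1 - 1) * repSum F A p.2 := by
    intro p hp
    rw [← sum_mul, ← sum_div]
    by_cases hp0 : p.1 = 0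
    · simp [hp0]
    · obtain ⟨L, _, _, _, hL⟩ := exists_field_finrank_eq F hp0
      have h5 := sum_finrank_quotient_eq (F := F) (A := A) (L := L) (n := n)
        (hL.le.trans (Nat.le.intro (HasAntidiagonal.mem_antidiagonal.1 hp))) (hL ▸ hp0)
      rw [hN L, hL] at h5
      rw [← h5]
      push_cast
      rfl
  rw [sum_congr rfl h2, ← mul_sum, ← mul_sum, sum_comm, sum_congr rfl h3] at h1
  rw [repSum, ← mul_div_assoc, h1, neg_mul, neg_div, mul_div_cancel_left₀ _ (glCard_ne_zero hq n)]

end Recursion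

/-! ### The product formula for the generating function and divisibility of its coefficients. -/

section GeneratingFunction

open PowerSeries Finset

/-- The derivation `t d/dt` of a power series ring. -/
noncomputable def eulerDerivation (R : Type*) [CommRing R] : Derivation R R⟦X⟧ R⟦X⟧ :=
  (X : R⟦X⟧) • d⁄dX R

theorem coeff_eulerDerivation {R : Type*} [CommRing R] (f : R⟦X⟧) (n : ℕ) :
    coeff n (eulerDerivation R f) = n * coeff n f := by
  rw [eulerDerivation, Derivation.smul_apply, smul_eq_mul]
  cases n with
  | zero => simp
  | succ n =>
    rw [coeff_succ_X_mul, coeff_derivative]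
    push_cast
    ring

theorem eulerDerivation_pow {R : Type*} [CommRing R] {f g : R⟦X⟧}
    (h : eulerDerivation R f = f * g) (n : ℕ) :
    eulerDerivation R (f ^ n) = f ^ n * (n * g) := by
  cases n with
  | zero => simp
  | succ n =>
    rw [Derivation.leibniz_pow, h, Nat.add_sub_cancel, nsmul_eq_mul, smul_eq_mul]
    ring

theorem eulerDerivation_prod {R ι : Type*} [CommRing R] {f g : ι → R⟦X⟧} (s : Finset ι)
    (h : ∀ i ∈ s, eulerDerivation R (f i) = f i * g i) :
    eulerDerivation R (∏ i ∈ s, f i) = (∏ i ∈ s, f i) * ∑ i ∈ s, g i := by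
  classical
  induction s using Finset.induction_on with
  | empty => simp
  | insert a s ha ih =>
    rw [prod_insert ha, sum_insert ha, Derivation.leibniz, h a (mem_insert_self a s),
      ih fun i hi => h i (mem_insert_of_mem hi), smul_eq_mul, smul_eq_mul]
    ring

/-- The geometric series `∑ aⁿ tⁿ`. -/
def geomSeries {R : Type*} [CommRing R] (a : R) : R⟦X⟧ := mk fun n => a ^ n

theorem one_sub_mul_geomSeries {R : Type*} [CommRing R] (a : R) :
    (1 - C a * X) * geomSeries a = 1 := by
  ext n
  cases n with
  | zero => simp [geomSeries]
  | succ n =>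
    rw [sub_mul, one_mul, mul_assoc, map_sub, coeff_C_mul, coeff_succ_X_mul]
    simp [geomSeries, coeff_one, pow_succ, mul_comm]

theorem eulerDerivation_one_sub {R : Type*} [CommRing R] (a : R) :
    eulerDerivation R (1 - C a * X) = (1 - C a * X) * -(geomSeries a - 1) := by
  have h : eulerDerivation R (1 - C a * X) = -(C a * X) := by
    ext n
    rw [coeff_eulerDerivation]
    rcases n with _ | _ | n <;> simp [coeff_one]
  rw [h]
  linear_combination one_sub_mul_geomSeries a

theorem eulerDerivation_geomSeries {R : Type*} [CommRing R] (a : R) :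
    eulerDerivation R (geomSeries a) = geomSeries a * (geomSeries a - 1) := by
  have h := congrArg (eulerDerivation R) (one_sub_mul_geomSeries a)
  rw [Derivation.leibniz, eulerDerivation_one_sub, Derivation.map_one_eq_zero, smul_eq_mul,
    smul_eq_mul] at h
  linear_combination geomSeries a * h +
    (-eulerDerivation R (geomSeries a) + geomSeries a * (geomSeries a - 1)) *
      one_sub_mul_geomSeries a

/-- The factor `(1 - qʲt)` or its inverse, according to the parity of `j`. -/
noncomputable def linearFactor (j : ℕ) : (Polynomial ℤ)⟦X⟧ :=
  if Even j then 1 - C (Polynomial.X ^ j) * X else geomSeries (Polynomial.X ^ j)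

theorem eulerDerivation_linearFactor (j : ℕ) :
    eulerDerivation _ (linearFactor j) =
      linearFactor j * ((-1) ^ (j + 1) * (geomSeries (Polynomial.X ^ j) - 1)) := by
  unfold linearFactor
  split_ifs with h
  · rw [eulerDerivation_one_sub, pow_succ, h.neg_one_pow]
    ring
  · rw [eulerDerivation_geomSeries, pow_succ, (Nat.not_even_iff_odd.1 h).neg_one_pow]
    ring

/-- The generating function `∏ⱼ (1 - qʲt) ^ ((-1)ʲ (2s choose j))`. -/
noncomputable def chiSeries (s : ℕ) : (Polynomial ℤ)⟦X⟧ :=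
  ∏ j ∈ range (2 * s + 1), linearFactor j ^ (2 * s).choose j

/-- Logarithmic differentiation turns the product into `∑ⱼ (-1)^(j+1) (2s choose j) q^(j*k)` in
degree `k > 0`, which is `-(q^k - 1)^(2s)` by the binomial theorem. The case `p.1 = 0` is excluded
explicitly because the power would be `0^0 = 1` for `s = 0`. -/
theorem natCast_mul_coeff_chiSeries (s n : ℕ) :
    (n : Polynomial ℤ) * coeff n (chiSeries s) = -∑ p ∈ antidiagonal n,
      (if p.1 = 0 then 0 else (Polynomial.X ^ p.1 - 1) ^ (2 * s)) * coeff p.2 (chiSeries s) := by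
  have h := eulerDerivation_prod (range (2 * s + 1)) fun j _ =>
    eulerDerivation_pow (eulerDerivation_linearFactor j) ((2 * s).choose j)
  rw [← chiSeries] at h
  have hW : ∑ j ∈ range (2 * s + 1), (((2 * s).choose j : (Polynomial ℤ)⟦X⟧) *
      ((-1) ^ (j + 1) * (geomSeries (Polynomial.X ^ j) - 1))) =
      -mk fun k => if k = 0 then 0 else (Polynomial.X ^ k - 1) ^ (2 * s) := by
    ext1 k
    have hc : ∀ j, coeff k (((2 * s).choose j : (Polynomial ℤ)⟦X⟧) *
        ((-1) ^ (j + 1) * (geomSeries (Polynomial.X ^ j) - 1))) =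
        ((2 * s).choose j : Polynomial ℤ) * ((-1) ^ (j + 1) *
          ((Polynomial.X ^ j) ^ k - if k = 0 then 1 else 0)) := by
      intro j
      rw [show (((2 * s).choose j : (Polynomial ℤ)⟦X⟧) *
        ((-1) ^ (j + 1) * (geomSeries (Polynomial.X ^ j) - 1))) =
        C (((2 * s).choose j : Polynomial ℤ) * (-1) ^ (j + 1)) *
          (geomSeries (Polynomial.X ^ j) - 1) by simp [mul_assoc], coeff_C_mul, map_sub,
          coeff_one, geomSeries, coeff_mk, mul_assoc]
    rw [map_sum, sum_congr rfl fun j _ => hc j, map_neg, coeff_mk]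
    split_ifs with hk
    · subst hk
      simp
    · rw [← Even.neg_pow (even_two_mul s), neg_sub, sub_eq_neg_add, add_pow, ← sum_neg_distrib]
      refine sum_congr rfl fun j _ => ?_
      rw [neg_pow (Polynomial.X ^ k : Polynomial ℤ), ← pow_mul, ← pow_mul, mul_comm k j]
      ring
  have h' := congrArg (coeff n) h
  rw [coeff_eulerDerivation, hW, mul_neg, map_neg, mul_comm (chiSeries s), coeff_mul] at h'
  simpa using h'

theorem coeff_zero_chiSeries (s : ℕ) : coeff 0 (chiSeries s) = 1 := by
  rw [coeff_zero_eq_constantCoeff, chiSeries, map_prod]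
  refine prod_eq_one fun j _ => ?_
  rw [map_pow, linearFactor]
  split_ifs
  · simp
  · rw [geomSeries, ← coeff_zero_eq_constantCoeff_apply, coeff_mk, pow_zero, one_pow]

/-- The power series in `q t`, coefficientwise. -/
def IsDivisibleSeries (f : (Polynomial ℤ)⟦X⟧) : Prop := ∀ n, Polynomial.X ^ n ∣ coeff n f

theorem IsDivisibleSeries.mul {f g : (Polynomial ℤ)⟦X⟧} (hf : IsDivisibleSeries f)
    (hg : IsDivisibleSeries g) : IsDivisibleSeries (f * g) := by
  intro n
  rw [coeff_mul]
  refine dvd_sum fun p hp => ?_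
  rw [← HasAntidiagonal.mem_antidiagonal.1 hp, pow_add]
  exact mul_dvd_mul (hf _) (hg _)

theorem isDivisibleSeries_one : IsDivisibleSeries 1 := by
  intro n
  rw [coeff_one]
  split_ifs with h
  · simp [h]
  · simp

theorem IsDivisibleSeries.pow {f : (Polynomial ℤ)⟦X⟧} (hf : IsDivisibleSeries f) (n : ℕ) :
    IsDivisibleSeries (f ^ n) := by
  induction n with
  | zero => rw [pow_zero]; exact isDivisibleSeries_one
  | succ n ih => rw [pow_succ]; exact ih.mul hf

theorem isDivisibleSeries_linearFactor (j : ℕ) : IsDivisibleSeries (linearFactor (j + 1)) := by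
  intro n
  unfold linearFactor
  split_ifs
  · rcases n with _ | _ | n
    · simp
    · rw [map_sub, coeff_C_mul, coeff_one]
      simp [pow_succ]
    · rw [map_sub, coeff_C_mul, coeff_one, coeff_X]
      simp
  · rw [geomSeries, coeff_mk, ← pow_mul]
    exact pow_dvd_pow _ (Nat.le_mul_of_pos_left n j.succ_pos)

theorem X_pow_dvd_coeff_chiSeries (s n : ℕ) :
    (Polynomial.X ^ (n - 1) : Polynomial ℤ) ∣ coeff n (chiSeries s) := by
  have hd : IsDivisibleSeries
      (∏ j ∈ range (2 * s), linearFactor (j + 1) ^ (2 * s).choose (j + 1)) := by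
    refine prod_induction _ IsDivisibleSeries (fun _ _ => IsDivisibleSeries.mul)
      isDivisibleSeries_one fun j _ => (isDivisibleSeries_linearFactor j).pow _
  -- The factor `j = 0` is `1 - t`, so the coefficient is a difference of the coefficients of `t^n`
  -- and `t^(n-1)` in a series in `q t`.
  rw [chiSeries, prod_range_succ', Nat.choose_zero_right, pow_one, linearFactor,
    if_pos Even.zero, pow_zero, map_one, one_mul, mul_sub, mul_one, map_sub]
  refine dvd_sub ((pow_dvd_pow _ (Nat.sub_le n 1)).trans (hd n)) ?_
  cases n with
  | zero => simp
  | succ n => rw [coeff_succ_mul_X]; exact hd n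

end GeneratingFunction

/-! ### From homomorphisms to representations, and comparison of the two recursions. -/

section Assembly

/-- Homomorphisms from `ℤ^r` are tuples. -/
noncomputable def zpowHomEquiv (r : ℕ) (G : Type*) [CommGroup G] :
    (Multiplicative (Fin r → ℤ) →* G) ≃ (Fin r → G) :=
  AddMonoidHom.toMultiplicativeLeft.symm.trans
    ((addMonoidHomLequivInt (A := Fin r → ℤ) (B := Additive G) ℤ).toEquiv.trans
      ((Pi.basisFun ℤ (Fin r)).constr ℤ).symm.toEquiv)

/-- Homomorphisms to the unit group of a monoid are homomorphisms to the monoid. -/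
def monoidHomUnitsEquiv (G M : Type*) [Group G] [Monoid M] : (G →* M) ≃ (G →* Mˣ) where
  toFun := MonoidHom.toHomUnits
  invFun f := (Units.coeHom M).comp f
  left_inv f := by ext; rfl
  right_inv f := by ext; rfl

/-- The group algebra of `ℤ^r`. -/
abbrev zpowAlgebra (F : Type*) [Field F] (r : ℕ) : Type _ :=
  MonoidAlgebra F (Multiplicative (Fin r → ℤ))

/-- A point of the group algebra is an `r`-tuple of units of `L`. -/
theorem natCard_algHom_zpowAlgebra (F : Type*) [Field F] (r : ℕ) (L : Type*) [Field L] [Finite L]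
    [Algebra F L] : Nat.card (zpowAlgebra F r →ₐ[F] L) = (Nat.card L - 1) ^ r := by
  rw [← Nat.card_congr (MonoidAlgebra.lift F L (Multiplicative (Fin r → ℤ))),
    Nat.card_congr ((monoidHomUnitsEquiv _ L).trans (zpowHomEquiv r Lˣ)), Nat.card_fun,
    Nat.card_units]
  simp

variable {F : Type u} [Field F]

theorem mem_fixedPoints_range_iff {G V : Type*} [Group G] [AddCommGroup V] [Module F V]
    (X : G →* LinearMap.GeneralLinearGroup F V) (W : ProperSubspaces F V) :
    W ∈ MulAction.fixedPoints X.range (ProperSubspaces F V) ↔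
      ∀ g, ∀ w ∈ W.1, (X g : Module.End F V) w ∈ W.1 := by
  have hsmul : ∀ g, ((⟨X g, g, rfl⟩ : X.range) • W).1 = W.1.map (X g : Module.End F V) :=
    fun _ => rfl
  constructor
  · intro h g w hw
    rw [← congrArg Subtype.val (h ⟨X g, g, rfl⟩), hsmul]
    exact Submodule.mem_map_of_mem hw
  · rintro h ⟨_, g, rfl⟩
    refine Subtype.ext ((hsmul g).trans (le_antisymm ?_ fun w hw => ?_))
    · rintro _ ⟨w, hw, rfl⟩
      exact h g w hw
    · refine ⟨(X g⁻¹ : Module.End F V) w, h g⁻¹ w hw, ?_⟩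
      change ((X g : Module.End F V) * (X g⁻¹ : Module.End F V)) w = w
      rw [← Units.val_mul, ← map_mul, mul_inv_cancel, map_one]
      rfl

variable {r n : ℕ} (X : Multiplicative (Fin r → ℤ) →* LinearMap.GeneralLinearGroup F (Fin n → F))

/-- The representation of the group algebra given by a homomorphism to the general linear
group. -/
noncomputable def repOfHom : zpowAlgebra F r →ₐ[F] Module.End F (Fin n → F) :=
  MonoidAlgebra.lift F _ _ ((Units.coeHom _).comp X)

theorem repOfHom_of (g : Multiplicative (Fin r → ℤ)) :
    repOfHom X (MonoidAlgebra.of F _ g) = (X g : Module.End F (Fin n → F)) := by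
  rw [repOfHom, MonoidAlgebra.lift_of]
  rfl

/-- The subspace underlying a submodule. -/
noncomputable def underlyingSubspace {ρ : zpowAlgebra F r →ₐ[F] Module.End F (Fin n → F)}
    (N : Submodule (zpowAlgebra F r) (RepMod ρ)) : Submodule F (Fin n → F) :=
  (N.restrictScalars F).comap (RepMod.of ρ).toLinearMap

theorem underlyingSubspace_le_iff {ρ : zpowAlgebra F r →ₐ[F] Module.End F (Fin n → F)}
    {N N' : Submodule (zpowAlgebra F r) (RepMod ρ)} :
    underlyingSubspace N ≤ underlyingSubspace N' ↔ N ≤ N' := Iff.rfl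

variable [Finite F]

theorem redEulerChar_fixedPoints :
    redEulerChar (MulAction.fixedPoints X.range (ProperSubspaces F (Fin n → F))) =
      redEulerChar {N : Submodule (zpowAlgebra F r) (RepMod (repOfHom X)) // N ≠ ⊥ ∧ N ≠ ⊤} := by
  have hinj : Function.Injective (underlyingSubspace (ρ := repOfHom X)) := fun N N' h =>
    le_antisymm (underlyingSubspace_le_iff.1 h.le) (underlyingSubspace_le_iff.1 h.ge)
  have hbot : underlyingSubspace (⊥ : Submodule (zpowAlgebra F r) (RepMod (repOfHom X))) = ⊥ := rfl
  have htop : underlyingSubspace (⊤ : Submodule (zpowAlgebra F r) (RepMod (repOfHom X))) = ⊤ := rfl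
  let f : {N : Submodule (zpowAlgebra F r) (RepMod (repOfHom X)) // N ≠ ⊥ ∧ N ≠ ⊤} ↪o
      MulAction.fixedPoints X.range (ProperSubspaces F (Fin n → F)) :=
    OrderEmbedding.ofMapLEIff (fun N => ⟨⟨underlyingSubspace N.1,
        fun h => N.2.1 (hinj (h.trans hbot.symm)), fun h => N.2.2 (hinj (h.trans htop.symm))⟩,
      (mem_fixedPoints_range_iff X _).2 fun g w hw => by
        rw [← repOfHom_of]
        exact N.1.smul_mem (MonoidAlgebra.of F _ g) hw⟩) fun N N' => Iff.rfl
  refine (redEulerChar_congr (RelIso.ofSurjective f ?_)).symm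
  rintro ⟨⟨W, hW⟩, hWX⟩
  have hW' := (mem_fixedPoints_range_iff X _).1 hWX
  have hmem : ∀ (a : zpowAlgebra F r), ∀ w ∈ W, repOfHom X a w ∈ W := by
    intro a
    induction a using MonoidAlgebra.induction_on with
    | of g => rw [repOfHom_of]; exact hW' g
    | add a b ha hb =>
      intro w hw
      rw [map_add]
      exact W.add_mem (ha w hw) (hb w hw)
    | smul c a ha =>
      intro w hw
      rw [map_smul]
      exact W.smul_mem c (ha w hw)
  let N : Submodule (zpowAlgebra F r) (RepMod (repOfHom X)) :=
    { W.toAddSubmonoid with smul_mem' := fun a w hw => hmem a w hw }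
  have hN : underlyingSubspace N = W := rfl
  exact ⟨⟨N, fun h => hW.1 (by rw [← hN, h, hbot]), fun h => hW.2 (by rw [← hN, h, htop])⟩, rfl⟩

theorem chiGL_eq_repSum (hn : 1 ≤ n) : chiGL r n F = repSum F (zpowAlgebra F r) n := by
  have : Nonempty (Fin n) := ⟨⟨0, hn⟩⟩
  let e : (Multiplicative (Fin r → ℤ) →* LinearMap.GeneralLinearGroup F (Fin n → F)) ≃
      (zpowAlgebra F r →ₐ[F] Module.End F (Fin n → F)) :=
    (monoidHomUnitsEquiv _ _).symm.trans (MonoidAlgebra.lift F _ _)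
  rw [chiGL, eqvRedEulerChar, repSum, div_eq_inv_mul,
    Nat.card_congr (LinearMap.GeneralLinearGroup.generalLinearEquiv F (Fin n → F)).toEquiv,
    card_linearEquiv_pi, ← finsum_eq_sum_of_fintype]
  congr 1
  refine finsum_eq_of_bijective e e.bijective fun X => ?_
  -- Hall's theorem needs `⊥ ≠ ⊤`, which is where `n ≥ 1` enters: for `n = 0` the empty poset gives
  -- `-1` but the Möbius number is `1`.
  have hnt : Nontrivial (RepMod (repOfHom X)) := inferInstanceAs (Nontrivial (Fin n → F))
  rw [redEulerChar_fixedPoints, redEulerChar_eq_moebiusNumber]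
  rfl

theorem repSum_zero (A : Type*) [CommRing A] [Algebra F A] [Algebra.FiniteType F A] :
    repSum F A 0 = 1 := by
  have : Unique (A →ₐ[F] Module.End F (Fin 0 → F)) :=
    { default := ⟨⟨⟨⟨fun _ => 0, Subsingleton.elim _ _⟩, fun _ _ => Subsingleton.elim _ _⟩,
        Subsingleton.elim _ _, fun _ _ => Subsingleton.elim _ _⟩, fun _ => Subsingleton.elim _ _⟩
      uniq := fun f => AlgHom.ext fun _ => Subsingleton.elim _ _ }
  have h : ∀ ρ : A →ₐ[F] Module.End F (Fin 0 → F), repMoebius ρ = 1 := by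
    intro ρ
    have : Subsingleton (RepMod ρ) := inferInstanceAs (Subsingleton (Fin 0 → F))
    rw [repMoebius, moebiusNumber_of_subsingleton, Int.cast_one]
  rw [repSum, Finset.sum_congr rfl fun ρ _ => h ρ]
  simp [glCard]

theorem repSum_zpowAlgebra (s n : ℕ) :
    repSum F (zpowAlgebra F (2 * s + 1)) n =
      (((PowerSeries.coeff n (chiSeries s)).eval (Nat.card F : ℤ) : ℤ) : ℚ) := by
  have hq : 1 < Nat.card F := Finite.one_lt_card
  induction n using Nat.strong_induction_on with
  | _ n ih =>
  rcases Nat.eq_zero_or_pos n with rfl | hn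
  · rw [repSum_zero, coeff_zero_chiSeries]
    simp
  · have h1 := natCast_mul_repSum (F := F) (A := zpowAlgebra F (2 * s + 1))
      (fun k => (Nat.card F ^ k - 1) ^ (2 * s + 1)) (fun L _ _ _ => by
        have : Module.Finite F L := inferInstance
        rw [natCard_algHom_zpowAlgebra, Module.natCard_eq_pow_finrank (K := F) (V := L)]) n
    have h2 := congrArg (fun P => ((Polynomial.eval (Nat.card F : ℤ) P : ℤ) : ℚ))
      (natCast_mul_coeff_chiSeries s n)
    simp only [Polynomial.eval_mul, Polynomial.eval_natCast, Polynomial.eval_neg,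
      Polynomial.eval_finsetSum, Int.cast_mul, Int.cast_neg, Int.cast_sum,
      Int.cast_natCast] at h2
    have hn' : (n : ℚ) ≠ 0 := by exact_mod_cast hn.ne'
    refine mul_left_cancel₀ hn' (h1.trans (Eq.trans ?_ h2.symm))
    congr 1
    refine Finset.sum_congr rfl fun p hp => ?_
    have hp' := Finset.HasAntidiagonal.mem_antidiagonal.1 hp
    -- The term `p.1 = 0` is zero in both recursions, so only indices `p.2 < n` occur. In the others
    -- one factor of `(q^k - 1)^(2s+1)` cancels the denominator.
    by_cases hp0 : p.1 = 0
    · simp [hp0]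
    · rw [ih p.2 (by omega), if_neg hp0]
      have hne : (Nat.card F : ℚ) ^ p.1 - 1 ≠ 0 :=
        (sub_pos.2 (one_lt_pow₀ (by exact_mod_cast hq) hp0)).ne'
      congr 1
      rw [Nat.cast_pow, Nat.cast_sub (Nat.one_le_pow _ _ (by omega))]
      simp only [Polynomial.eval_pow, Polynomial.eval_sub, Polynomial.eval_X, Polynomial.eval_one]
      push_cast
      rw [pow_succ, mul_div_assoc, div_self hne, mul_one]

theorem exists_finite_field_natCard_eq {p : ℕ} (hp : p.Prime) :
    ∃ (K : Type u) (_ : Field K), Finite K ∧ Nat.card K = p := by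
  have : Fact p.Prime := ⟨hp⟩
  exact ⟨ULift (ZMod p), inferInstance, inferInstance, by simp⟩

theorem RepresentsChiGL.unique {r n : ℕ} {P Q : Polynomial ℤ} (hP : RepresentsChiGL.{u} r n P)
    (hQ : RepresentsChiGL.{u} r n Q) : P = Q := by
  refine Polynomial.eq_of_infinite_eval_eq P Q ?_
  refine (Nat.infinite_setOfPred_prime.image (f := fun p : ℕ => (p : ℤ))
    Nat.cast_injective.injOn).mono ?_
  rintro _ ⟨p, hp, rfl⟩
  obtain ⟨K, _, _, hK⟩ := exists_finite_field_natCard_eq.{u} hp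
  have h := (hP K).symm.trans (hQ K)
  rw [hK] at h
  exact_mod_cast h

end Assembly

theorem mainTheorem6 (r n : ℕ) (hr : Odd r) (hn : 1 ≤ n) :
    ∃ P : Polynomial ℤ,
      RepresentsChiGL.{u} r n P ∧
      (∀ Q : Polynomial ℤ, RepresentsChiGL.{u} r n Q → Q = P) ∧
      Polynomial.X ^ (n - 1) ∣ P := by
  obtain ⟨s, rfl⟩ := hr
  have h : RepresentsChiGL.{u} (2 * s + 1) n (PowerSeries.coeff n (chiSeries s)) := by
    intro F _ _
    rw [chiGL_eq_repSum hn, repSum_zpowAlgebra]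
  exact ⟨_, h, fun Q hQ => hQ.unique h, X_pow_dvd_coeff_chiSeries s n⟩
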